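/- **Setting.** Let $\mathcal E=\{F=0\}\subset J^1$ be a (nonlinear) system of $r$ first-order partial differential equations for $m$ unknown functions of $n$ independent variables, where $F$ is a smooth $\mathbb R^r$-valued function on an open set of the space of $1$-jets of maps $\mathbb R^n\to\mathbb R^m$, and the derivative of $F$ along the fibres of $J^1\to J^0$ is onto at every point of $\mathcal E$. Put $T=\mathbb R^n$, $N=\mathbb R^m$. For $k\ge 1$ let $\mathcal E_k\subset J^k$ be the $(k-1)$-st prolongation of $\mathcal E$. At $\theta\in\mathcal E$ let $g_0=N$, let $g_1\subset T^*\otimes N$ be the kernel of the fibre derivative of $F$ at $\theta$ (the common kernel of the symbols of the equations), and let $g_k=g_1^{(k-1)}\subset S^kT^*\otimes N$ be its prolongations, i.e. the $N$-valued homogeneous polynomials of degree $k$ on $T$ all of whose derivatives of order $k-1$ lie in $g_1$. The system is *formally integrable*: the dimensions of the $g_k$ are locally constant on $\mathcal E$, and the projections $\mathcal E_{k+1}\to\mathcal E_k$ are surjective for all $k\ge1$. Let $H^{i,j}(g)$ be the Spencer $\delta$-cohomology of $g=(g_k)$, i.e. the cohomology at the term $g_i\otimes\Lambda^jT^*$ of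 the complex $\dots\to g_{i+1}\otimes\Lambda^{j-1}T^*\xrightarrow{\delta} g_i\otimes\Lambda^jT^*\xrightarrow{\delta} g_{i-1}\otimes\Lambda^{j+1}T^*\to\cdots$ (exterior derivative of polynomial forms, $g_{-1}=0$), and let $h^{i,j}=\dim H^{i,j}(g)$. The symbolic system $g$ is *involutive* if, for every $k\ge1$, the symbolic system $g^{|k\rangle}$ generated by $g_k$ (equal to $S^iT^*\otimes N$ for $i<k$ and to $g_k^{(i-k)}$ for $i\ge k$) satisfies $H^{i,j}(g^{|k\rangle})=0$ for all $i\ge k$ and all $j$. The symbolic module is the graded dual $g^*=\bigoplus_k g_k^*$, a module over the symmetric algebra $ST$, with $T$ acting by the transposes of differentiation. The complex characteristic variety $\mathrm{Char}^{\mathbb C}\subset\mathbb P(T^*\otimes\mathbb C)$ is the support of the complexification of $g^*$; the empty set is given dimension $-1$, hence codimension $n$. The Hilbert polynomial $P$ of $g^*$ is the polynomial with $P(k)=\sum_{i\le k}\dim g_i^*$ for all large integers $k$. The functional dimension is $\deg P$ (taken to be $0$ if $P=0$), and the functional rank is $\sigma=P^{(d)}$ with $d$ the functional dimension; that is, the highest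 term of $P(z)$ is $\sigma z^d/d!$. **Theorem.** Let $\mathcal E$ be formally integrable, let $\theta\in\mathcal E$ be a point at which the symbolic system $g$ is involutive, let $0\le p\le n$, and suppose that the complex characteristic variety at $\theta$ has codimension $n-p$ in $\mathbb P(T^*\otimes\mathbb C)$. Then the Hilbert polynomial $P$ of the symbolic module $g^*$ at $\theta$ exists, the functional dimension is $p$, and the functional rank is $$\sigma=\sum_{i=0}^{n}(-1)^i\,h^{0,i}\,\frac{(-i)^{n-p}}{(n-p)!}\qquad(\text{with }0^0=1).$$ -/

import Mathlib

open scoped Topology TensorProduct LinearAlgebra.Projectivization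
open Asymptotics Filter

attribute [local instance] MvPolynomial.algebraMvPolynomial

noncomputable section

namespace SpencerPDE

/-! ### Symbolic systems

Throughout `T = ℝⁿ` and `N = ℝᵐ`.  An `N`-valued polynomial on `T` is given by its `m` components,
and `S^k T* ⊗ N` is the space of `N`-valued homogeneous polynomials of degree `k` on `T`. -/

/-- `N`-valued polynomials on `T`, that is, `S T* ⊗ N`. -/
abbrev VPoly (n m : ℕ) : Type := Fin m → MvPolynomial (Fin n) ℝ

/-- `S^k T* ⊗ N`. -/
def homog (n m k : ℕ) : Submodule ℝ (VPoly n m) :=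
  Submodule.pi Set.univ fun _ => MvPolynomial.homogeneousSubmodule (Fin n) ℝ k

/-- The coordinate derivative `∂ᵢ` of an `N`-valued polynomial. -/
def partialD (n m : ℕ) (i : Fin n) : Module.End ℝ (VPoly n m) :=
  LinearMap.compLeft (MvPolynomial.pderiv i).toLinearMap (Fin m)

/-- `δ_v = ∑ᵢ vᵢ ∂ᵢ`, the differentiation along the vector `v ∈ T`, linear in `v`. -/
def dirD (n m : ℕ) : (Fin n → ℝ) →ₗ[ℝ] Module.End ℝ (VPoly n m) :=
  ∑ i, (LinearMap.proj i : (Fin n → ℝ) →ₗ[ℝ] ℝ).smulRight (partialD n m i)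

lemma mem_homog {n m k : ℕ} {p : VPoly n m} :
    p ∈ homog n m k ↔ ∀ a, (p a).IsHomogeneous k := by
  simp [homog, Submodule.mem_pi]

lemma dirD_apply {n m : ℕ} (v : Fin n → ℝ) (p : VPoly n m) (a : Fin m) :
    dirD n m v p a = ∑ i, v i • MvPolynomial.pderiv i (p a) := by
  simp [dirD, partialD, LinearMap.sum_apply, Finset.sum_apply]

lemma dirD_single {n m : ℕ} (i : Fin n) (p : VPoly n m) (a : Fin m) :
    dirD n m (Pi.single i 1) p a = MvPolynomial.pderiv i (p a) := by
  rw [dirD_apply, Finset.sum_eq_single i] <;> simp +contextual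

lemma dirD_mem_homog {n m k : ℕ} (v : Fin n → ℝ) {p : VPoly n m} (hp : p ∈ homog n m (k + 1)) :
    dirD n m v p ∈ homog n m k := by
  rw [mem_homog] at hp ⊢
  intro a
  rw [dirD_apply]
  refine MvPolynomial.IsHomogeneous.sum _ _ _ fun i _ => ?_
  rw [MvPolynomial.smul_eq_C_mul]
  simpa using (MvPolynomial.isHomogeneous_C (Fin n) (v i)).mul ((hp a).pderiv (i := i))

/-- A symbolic system: subspaces `g_k ⊆ S^k T* ⊗ N` with `g_0 = N` and
`g_{k+1} ⊆ g_k^{(1)}`, i.e. `δ_v g_{k+1} ⊆ g_k` for all `v ∈ T`. -/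
structure SymbolicSystem (n m : ℕ) where
  g : ℕ → Submodule ℝ (VPoly n m)
  le_homog : ∀ k, g k ≤ homog n m k
  g_zero : g 0 = homog n m 0
  dirD_mem : ∀ k, ∀ p ∈ g (k + 1), ∀ v, dirD n m v p ∈ g k

/-- The `l`-th prolongation `h^{(l)} ⊆ S^{k+l} T* ⊗ N` of a subspace `h ⊆ S^k T* ⊗ N`:
the elements all of whose `l`-fold derivatives `δ_{v₁} ⋯ δ_{v_l} p` are in `h`. -/
def prolongation {n m : ℕ} (k : ℕ) (h : Submodule ℝ (VPoly n m)) : ℕ → Submodule ℝ (VPoly n m)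
  | 0 => h
  | l + 1 => homog n m (k + l + 1) ⊓ ⨅ v, (prolongation k h l).comap (dirD n m v)

/-- The symbolic system generated in order `k ≥ 1` by `h ⊆ S^k T* ⊗ N`:
it is `S^i T* ⊗ N` for `i < k` and `h^{(i-k)}` for `i ≥ k`. -/
def generated {n m : ℕ} (k : ℕ) (hk : 1 ≤ k) (h : Submodule ℝ (VPoly n m))
    (hh : h ≤ homog n m k) : SymbolicSystem n m where
  g i := if i < k then homog n m i else prolongation k h (i - k)
  le_homog i := by
    split_ifs with hi
    · exact le_rfl
    · obtain ⟨l, rfl⟩ : ∃ l, i = k + l := ⟨i - k, by omega⟩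
      rw [Nat.add_sub_cancel_left]
      cases l with
      | zero => simpa [prolongation] using hh
      | succ l => exact inf_le_left
  g_zero := if_pos (by omega)
  dirD_mem i p hp v := by
    rcases lt_trichotomy (i + 1) k with hi | hi | hi
    · rw [if_pos hi] at hp
      rw [if_pos (by omega)]
      exact dirD_mem_homog v hp
    · subst hi
      rw [if_neg (by omega)] at hp
      rw [if_pos (by omega)]
      exact dirD_mem_homog v (hh (by simpa [prolongation] using hp))
    · obtain ⟨l, rfl⟩ : ∃ l, i = k + l := ⟨i - k, by omega⟩
      rw [if_neg (by omega), show k + l + 1 - k = l + 1 by omega] at hp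
      rw [if_neg (by omega), Nat.add_sub_cancel_left]
      exact (Submodule.mem_iInf _).1 hp.2 v

/-! ### Spencer `δ`-cohomology -/

/-- Polynomial `N`-valued differential `j`-forms on `T`: `S T* ⊗ N ⊗ Λ^j T*`. -/
abbrev Form (n m j : ℕ) : Type := (Fin n → ℝ) [⋀^Fin j]→ₗ[ℝ] VPoly n m

/-- The Spencer differential, i.e. the exterior derivative of polynomial forms:
`(δ ω)(v₀, …, v_j) = ∑ₛ (-1)^s δ_{v_s} (ω(v₀, …, v̂_s, …, v_j))`. -/
def spencerD (n m j : ℕ) : Form n m j →ₗ[ℝ] Form n m (j + 1) where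
  toFun ω := AlternatingMap.alternatizeUncurryFin
    { toFun := fun v => (dirD n m v).compAlternatingMap ω
      map_add' := fun v w => by ext; simp
      map_smul' := fun c v => by ext; simp }
  map_add' ω η := by
    rw [← AlternatingMap.alternatizeUncurryFin_add]
    congr 1
    ext v : 2
    simp
  map_smul' c ω := by
    rw [RingHom.id_apply, ← AlternatingMap.alternatizeUncurryFin_smul]
    congr 1
    ext v : 2
    simp

/-- The quotient `Z / B` of subspaces `B ⊆ Z` of a vector space (in general `Z / (B ∩ Z)`). -/
abbrev Subquotient {K V : Type} [Field K] [AddCommGroup V] [Module K V] (Z B : Submodule K V) :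
    Type :=
  Z ⧸ B.submoduleOf Z

namespace SymbolicSystem

variable {n m : ℕ} (g : SymbolicSystem n m)

/-- `g_i ⊗ Λ^j T*`. -/
def cochains (i j : ℕ) : Submodule ℝ (Form n m j) where
  carrier := {ω | ∀ v, ω v ∈ g.g i}
  zero_mem' _ := zero_mem _
  add_mem' h₁ h₂ v := add_mem (h₁ v) (h₂ v)
  smul_mem' c _ h v := Submodule.smul_mem _ c (h v)

/-- The kernel of `δ : g_i ⊗ Λ^j T* → g_{i-1} ⊗ Λ^{j+1} T*` (with `g_{-1} = 0`; note that `δ`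
vanishes on forms with constant coefficients). -/
def cocycles (i j : ℕ) : Submodule ℝ (Form n m j) :=
  g.cochains i j ⊓ LinearMap.ker (spencerD n m j)

/-- The image of `δ : g_{i+1} ⊗ Λ^{j-1} T* → g_i ⊗ Λ^j T*`. -/
def coboundaries (i : ℕ) : (j : ℕ) → Submodule ℝ (Form n m j)
  | 0 => ⊥
  | j + 1 => (g.cochains (i + 1) j).map (spencerD n m j)

/-- The Spencer `δ`-cohomology group `H^{i,j}(g)` at the term `g_i ⊗ Λ^j T*`. -/
abbrev cohomology (i j : ℕ) : Type :=
  Subquotient (g.cocycles i j) (g.coboundaries i j)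

/-- `h^{i,j} = dim H^{i,j}(g)`. -/
def h (i j : ℕ) : ℕ := Module.finrank ℝ (g.cohomology i j)

/-- `g^{|k⟩}`, the symbolic system generated by `g_k`. -/
def trunc (k : ℕ) (hk : 1 ≤ k) : SymbolicSystem n m :=
  generated k hk (g.g k) (g.le_homog k)

/-- `g` is involutive: `H^{i,j}(g^{|k⟩}) = 0` for all `i ≥ k` (and all `j`), for every order `k`. -/
def Involutive : Prop :=
  ∀ (k : ℕ) (hk : 1 ≤ k) (i j : ℕ), k ≤ i → Subsingleton ((g.trunc k hk).cohomology i j)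

end SymbolicSystem

/-! ### The symbolic module and the complex characteristic variety

`ST` is the algebra `MvPolynomial (Fin n) ℝ` of polynomials on `T*` (the variable `Xᵢ` stands for
the `i`-th coordinate vector of `T`), and `ST ⊗ N*` is `Fin m → MvPolynomial (Fin n) ℝ`. -/

/-- The pairing of `ST` with `ST*`: a polynomial acts on polynomials by differentiation at the
origin, `⟨f, q⟩ = (f(∂) q)(0)`, so that `⟨X^s, x^t⟩ = s!` if `s = t` and `0` otherwise. -/
def pairing (n : ℕ) : MvPolynomial (Fin n) ℝ →ₗ[ℝ] Module.Dual ℝ (MvPolynomial (Fin n) ℝ) :=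
  (MvPolynomial.basisMonomials (Fin n) ℝ).constr ℝ fun s =>
    (∏ i, ((s i).factorial : ℝ)) • MvPolynomial.lcoeff ℝ s

lemma pairing_monomial {n : ℕ} (s : Fin n →₀ ℕ) (q : MvPolynomial (Fin n) ℝ) :
    pairing n (MvPolynomial.monomial s 1) q = (∏ i, ((s i).factorial : ℝ)) * q.coeff s := by
  have := (MvPolynomial.basisMonomials (Fin n) ℝ).constr_basis ℝ (fun s =>
    (∏ i, ((s i).factorial : ℝ)) • MvPolynomial.lcoeff ℝ s) s
  rw [MvPolynomial.coe_basisMonomials] at this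
  simp [pairing, this]

/-- Multiplication by `Xᵢ` is dual to `∂ᵢ`. -/
lemma pairing_X_mul {n : ℕ} (i : Fin n) (f q : MvPolynomial (Fin n) ℝ) :
    pairing n (MvPolynomial.X i * f) q = pairing n f (MvPolynomial.pderiv i q) := by
  induction f using MvPolynomial.induction_on' with
  | add f₁ f₂ h₁ h₂ => rw [mul_add, map_add, map_add, LinearMap.add_apply, LinearMap.add_apply,
      h₁, h₂]
  | monomial s c =>
    have hc : MvPolynomial.monomial s c = c • MvPolynomial.monomial s (1 : ℝ) := by
      simp [MvPolynomial.smul_monomial]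
    rw [hc, mul_smul_comm, map_smul, map_smul, LinearMap.smul_apply, LinearMap.smul_apply]
    congr 1
    rw [MvPolynomial.X, MvPolynomial.monomial_mul, mul_one, pairing_monomial, pairing_monomial]
    have hfac : (∏ k, ((((Finsupp.single i 1 + s : Fin n →₀ ℕ) k).factorial : ℕ) : ℝ))
        = (s i + 1) * ∏ k, ((s k).factorial : ℝ) := by
      rw [← Finset.mul_prod_erase _ _ (Finset.mem_univ i),
        ← Finset.mul_prod_erase _ (fun k => ((s k).factorial : ℝ)) (Finset.mem_univ i),
        ← mul_assoc]
      congr 1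
      · simp [add_comm 1, Nat.factorial_succ]
      · refine Finset.prod_congr rfl fun k hk => ?_
        simp [(Finset.ne_of_mem_erase hk).symm]
    rw [hfac]
    induction q using MvPolynomial.induction_on' with
    | add q₁ q₂ h₁ h₂ =>
      simp only [map_add, MvPolynomial.coeff_add, mul_add] at h₁ h₂ ⊢
      rw [h₁, h₂]
    | monomial t d =>
      rw [MvPolynomial.pderiv_monomial, MvPolynomial.coeff_monomial, MvPolynomial.coeff_monomial]
      by_cases ht : t = Finsupp.single i 1 + s
      · subst ht
        simp
        ring
      · rw [if_neg ht]
        by_cases ht' : t - Finsupp.single i 1 = s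
        · rw [if_pos ht']
          have : t i = 0 := by
            by_contra h0
            apply ht
            rw [← ht', add_comm]
            exact (tsub_add_cancel_of_le (by simpa using Nat.one_le_iff_ne_zero.2 h0)).symm
          simp [this]
        · rw [if_neg ht']
          ring

namespace SymbolicSystem

variable {n m : ℕ} (g : SymbolicSystem n m)

/-- `g^⊥ ⊆ ST ⊗ N*`: the elements that annihilate all `g_k ⊆ S^k T* ⊗ N`. -/
def perp : Submodule (MvPolynomial (Fin n) ℝ) (Fin m → MvPolynomial (Fin n) ℝ) where
  carrier := {φ | ∀ k, ∀ p ∈ g.g k, ∑ a, pairing n (φ a) (p a) = 0}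
  zero_mem' := by simp
  add_mem' {φ ψ} h₁ h₂ k p hp := by
    simp [Finset.sum_add_distrib, h₁ k p hp, h₂ k p hp]
  smul_mem' (f : MvPolynomial (Fin n) ℝ) := by
    induction f using MvPolynomial.induction_on with
    | C c =>
      intro φ h k p hp
      have e := h k p hp
      have hc : ∀ a, pairing n (((MvPolynomial.C c : MvPolynomial (Fin n) ℝ) • φ) a) (p a) =
          c * pairing n (φ a) (p a) := by
        intro a
        rw [Pi.smul_apply, smul_eq_mul, ← MvPolynomial.smul_eq_C_mul, map_smul,
          LinearMap.smul_apply, smul_eq_mul]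
      rw [Finset.sum_congr rfl fun a _ => hc a, ← Finset.mul_sum, e, mul_zero]
    | add f₁ f₂ h₁ h₂ =>
      intro φ h k p hp
      have e₁ := h₁ h k p hp
      have e₂ := h₂ h k p hp
      simp only [Pi.smul_apply, smul_eq_mul] at e₁ e₂
      simp [add_mul, Finset.sum_add_distrib, e₁, e₂]
    | mul_X f i hf =>
      intro φ h
      have key : ((MvPolynomial.X i : MvPolynomial (Fin n) ℝ) • φ) ∈
          {φ | ∀ k, ∀ p ∈ g.g k, ∑ a, pairing n (φ a) (p a) = 0} := by
        intro k p hp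
        simp only [Pi.smul_apply, smul_eq_mul, pairing_X_mul]
        cases k with
        | zero =>
          refine Finset.sum_eq_zero fun a _ => ?_
          have h0 : (p a).IsHomogeneous 0 := mem_homog.1 (g.le_homog 0 hp) a
          rw [MvPolynomial.totalDegree_eq_zero_iff_eq_C.1
            (Nat.le_zero.1 h0.totalDegree_le), MvPolynomial.pderiv_C, map_zero]
        | succ k =>
          have := h k _ (g.dirD_mem k p hp (Pi.single i 1))
          simpa only [dirD_single] using this
      rw [mul_smul]
      exact hf key

/-- The symbolic module `g* = ⊕ g_k*` over `ST`.  The transposes `S^k T ⊗ N* → g_k*` of the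
inclusions `g_k ⊆ S^k T* ⊗ N` are onto with kernels `g_k^⊥`, and `ST` acts on `⊕ g_k*` by the
transposes of the differentiations; so `g*` is `(ST ⊗ N*) / g^⊥`. -/
abbrev symbolicModule : Type := (Fin m → MvPolynomial (Fin n) ℝ) ⧸ g.perp

/-- The complexified symbolic module, over the algebra of polynomials on `T* ⊗ ℂ`. -/
abbrev complexSymbolicModule : Type :=
  MvPolynomial (Fin n) ℂ ⊗[MvPolynomial (Fin n) ℝ] g.symbolicModule

/-- The complex characteristic variety in the projectivization of `T* ⊗ ℂ`, the support of the
symbolic module: the points `[ξ]` for which the localization of the complexified symbolic module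
at `ξ` is not zero. -/
def charVariety : Set (ℙ ℂ (Fin n → ℂ)) :=
  {P | ∃ (ξ : Fin n → ℂ) (hξ : ξ ≠ 0), Projectivization.mk ℂ ξ hξ = P ∧
    (MvPolynomial.pointToPoint ξ : PrimeSpectrum (MvPolynomial (Fin n) ℂ)) ∈
      Module.support (MvPolynomial (Fin n) ℂ) g.complexSymbolicModule}

end SymbolicSystem

/-- The affine cone in `ℂⁿ` over a subset of the projective space. -/
def affineCone {n : ℕ} (X : Set (ℙ ℂ (Fin n → ℂ))) : Set (Fin n → ℂ) :=
  {ξ | ξ = 0 ∨ ∃ hξ : ξ ≠ 0, Projectivization.mk ℂ ξ hξ ∈ X}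

/-- `X ⊆ ℙ(ℂⁿ)` has codimension `c`.  Here `dim X + 1` is the Krull dimension of the coordinate
ring of the affine cone over `X`, so that `c = (n - 1) - dim X`; the empty set has dimension `-1`
and codimension `n`. -/
def HasCodim {n : ℕ} (X : Set (ℙ ℂ (Fin n → ℂ))) (c : ℕ) : Prop :=
  ringKrullDim (MvPolynomial (Fin n) ℂ ⧸ MvPolynomial.vanishingIdeal ℂ (affineCone X)) + c = n

/-! ### The Hilbert polynomial and the functional rank -/

namespace SymbolicSystem

variable {n m : ℕ} (g : SymbolicSystem n m)

/-- `P(k) = ∑_{i ≤ k} dim g_i*` for all sufficiently large `k`. -/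
def IsHilbertPolynomial (P : Polynomial ℚ) : Prop :=
  ∀ᶠ k : ℕ in atTop,
    P.eval (k : ℚ) = ∑ i ∈ Finset.range (k + 1), (Module.finrank ℝ (Module.Dual ℝ (g.g i)) : ℚ)

open Classical in
/-- The Hilbert polynomial of the symbolic module (there is at most one). -/
def hilbertPolynomial : Polynomial ℚ :=
  if hP : ∃ P, g.IsHilbertPolynomial P then hP.choose else 0

/-- The functional dimension `p = deg P`. -/
def functionalDimension : ℕ := g.hilbertPolynomial.natDegree

/-- The functional rank `σ = P^{(p)}` with `p = deg P`; thus `P(z) = σ z^p / p! + …`. -/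
def functionalRank : ℚ :=
  (Polynomial.derivative^[g.functionalDimension] g.hilbertPolynomial).eval 0

end SymbolicSystem

/-! ### Systems of partial differential equations of pure first order -/

/-- The space of 1-jets of maps `ℝⁿ → ℝᵐ`: `(x, u, p)` with `p i a` the value of `∂ᵢ uᵃ`. -/
abbrev Jet1 (n m : ℕ) : Type := (Fin n → ℝ) × (Fin m → ℝ) × (Fin n → Fin m → ℝ)

/-- The derivative of `F` at `θ` along the fibre of `J¹ → J⁰`, `T* ⊗ N → ℝʳ`. -/
def fibreDeriv {n m r : ℕ} (F : Jet1 n m → Fin r → ℝ) (θ : Jet1 n m) :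
    (Fin n → Fin m → ℝ) →ₗ[ℝ] (Fin r → ℝ) :=
  (fderiv ℝ F θ).toLinearMap ∘ₗ LinearMap.inr ℝ _ _ ∘ₗ LinearMap.inr ℝ _ _

/-- A (nonlinear) system of `r` partial differential equations `F(x, u, ∂u) = 0` of first order
for `m` unknown functions of `n` independent variables, on an open domain of the space of 1-jets.
By `submersive`, the equation `{F = 0}` is a submanifold that is submersed to `J⁰`. -/
structure FirstOrderSystem (n m r : ℕ) where
  domain : Set (Jet1 n m)
  isOpen_domain : IsOpen domain
  F : Jet1 n m → Fin r → ℝ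
  smooth : ContDiffOn ℝ (⊤ : ℕ∞) F domain
  submersive : ∀ θ ∈ domain, F θ = 0 → Function.Surjective (fibreDeriv F θ)

/-- The 1-jet at the point `y` of the map `y ↦ u(y - x)`. -/
def jet1At {n m : ℕ} (x : Fin n → ℝ) (u : VPoly n m) (y : Fin n → ℝ) : Jet1 n m :=
  (y, fun a => MvPolynomial.eval (y - x) (u a),
    fun i a => MvPolynomial.eval (y - x) (MvPolynomial.pderiv i (u a)))

namespace FirstOrderSystem

variable {n m r : ℕ} (E : FirstOrderSystem n m r)

/-- The equation as a subset of the space of 1-jets. -/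
def equation : Set (Jet1 n m) := {θ | θ ∈ E.domain ∧ E.F θ = 0}

/-- The `(k-1)`-st prolongation `E_k` of the equation in the space of `k`-jets (`k ≥ 1`).
A `k`-jet at `x` is represented by its Taylor polynomial `u` of degree at most `k` in `y - x`; it
belongs to `E_k` if `F(y, u, ∂u)` vanishes at `y = x` together with its derivatives up to order
`k - 1`. -/
def prolongedEquation (k : ℕ) : Set ((Fin n → ℝ) × VPoly n m) :=
  {z | (∀ a, (z.2 a).totalDegree ≤ k) ∧ jet1At z.1 z.2 z.1 ∈ E.domain ∧
    (fun y => E.F (jet1At z.1 z.2 y)) =O[𝓝 z.1] fun y => ‖y - z.1‖ ^ k}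

/-- The symbol `g_1 ⊆ T* ⊗ N` of the equation at a 1-jet `θ`: the solutions of the linear
equations given by the symbols of the `F_ρ`. -/
def firstSymbol (θ : Jet1 n m) : Submodule ℝ (VPoly n m) where
  carrier := {q | q ∈ homog n m 1 ∧
    fibreDeriv E.F θ (fun i a => (MvPolynomial.pderiv i (q a)).coeff 0) = 0}
  zero_mem' := ⟨zero_mem _, by
    have : (fun (i : Fin n) (a : Fin m) =>
      (MvPolynomial.pderiv i ((0 : VPoly n m) a)).coeff 0) = 0 := by ext; simp
    rw [this, map_zero]⟩
  add_mem' {q₁ q₂} h₁ h₂ := ⟨add_mem h₁.1 h₂.1, by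
    have : (fun (i : Fin n) (a : Fin m) => (MvPolynomial.pderiv i ((q₁ + q₂) a)).coeff 0) =
      (fun i a => (MvPolynomial.pderiv i (q₁ a)).coeff 0) +
        fun i a => (MvPolynomial.pderiv i (q₂ a)).coeff 0 := by ext; simp
    rw [this, map_add, h₁.2, h₂.2, add_zero]⟩
  smul_mem' c q h := ⟨Submodule.smul_mem _ c h.1, by
    have : (fun (i : Fin n) (a : Fin m) => (MvPolynomial.pderiv i ((c • q) a)).coeff 0) =
      c • fun i a => (MvPolynomial.pderiv i (q a)).coeff 0 := by ext; simp
    rw [this, map_smul, h.2, smul_zero]⟩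

/-- The symbolic system of the equation at a 1-jet `θ`: `g_0 = N` and `g_k = g_1^{(k-1)}` for
`k ≥ 1`. -/
def symbol (θ : Jet1 n m) : SymbolicSystem n m :=
  generated 1 le_rfl (E.firstSymbol θ) fun _ hq => hq.1

/-- Formal integrability: the symbols `g_k` form vector bundles over the equation, and the
projections `E_{k+1} → E_k` are onto for all `k ≥ 1`. -/
structure FormallyIntegrable : Prop where
  regular : ∀ k : ℕ, ∀ θ ∈ E.equation, ∀ᶠ θ' in 𝓝[E.equation] θ,
    Module.finrank ℝ ((E.symbol θ').g k) = Module.finrank ℝ ((E.symbol θ).g k)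
  surjective : ∀ k : ℕ, 1 ≤ k → ∀ z ∈ E.prolongedEquation k,
    ∃ w ∈ homog n m (k + 1), (z.1, z.2 + w) ∈ E.prolongedEquation (k + 1)

end FirstOrderSystem

end SpencerPDE

end

noncomputable section

namespace SpencerPDE

/-! ### Krull dimension and annihilators under ring extensions -/

/-! The symbol is generated in order one, so involutivity for `k = 1` gives `H^{i,j}(g) = 0` for all
`i ≥ 1`. Each complex `g_k → g_{k-1} ⊗ T* → ⋯ → g_0 ⊗ Λ^k T*` is then exact except at its last term.
Its Euler characteristic says that the Hilbert series of `g` times `(1 - t)^n` is `Q(t) = ∑ (-1)^i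
h^{0,i} t^i` (`mk_finrank_mul_one_sub_X_pow`). Hence the partial sums of `dim g_i` have generating
series `Q(t) / (1 - t)^{n+1}`, so `P` exists and `P(z) = ∑ Q_i · binom(z - i + n, n)`. Its
coefficient in degree `n - c` is a combination of the moments `∑ Q_i (-i)^l` with `l ≤ c`. Once `deg
P = p` is known, the moments with `l < n - p` vanish and the one with `l = n - p` is the rank, up to
the factor `1 / (n-p)!` (`eval_iterate_derivative_hilbertPoly`).

The degree comes from growth. By Noether normalization an affine algebra of Krull dimension `s`
grows like `d^s`. A finite module over the polynomial ring `A` grows like `A` modulo its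
annihilator. The piece of `g*` of degree at most `d` has dimension `∑_{i ≤ d} dim g_i`
(`finrank_moduleFiltration`). Finally, the cone over the complex characteristic variety is the
complex zero locus of the annihilator, so by the Nullstellensatz and integrality of `ℂ[x]` over
`ℝ[x]` both have the same dimension (`IsHilbertPolynomial.natDegree_eq`). -/

theorem ringKrullDim_eq_of_isIntegral {R S : Type*} [CommRing R] [CommRing S] [Algebra R S]
    [Algebra.IsIntegral R S] (hinj : Function.Injective (algebraMap R S)) :
    ringKrullDim R = ringKrullDim S := by
  apply le_antisymm
  · have : FaithfulSMul R S := (faithfulSMul_iff_algebraMap_injective R S).2 hinj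
    refine iSup_le fun l => ?_
    obtain ⟨Q, -, hQ, hQl⟩ : ∃ Q ≥ (⊥ : Ideal S), Q.IsPrime ∧ Q.comap (algebraMap R S) = l.head.asIdeal :=
      Ideal.exists_ideal_over_prime_of_isIntegral l.head.asIdeal ⊥
        (by rw [← RingHom.ker_eq_comap_bot, (RingHom.injective_iff_ker_eq_bot _).1 hinj]
            exact bot_le)
    have : Q.LiesOver l.head.asIdeal := ⟨hQl.symm⟩
    obtain ⟨L, hL, -⟩ := Ideal.exists_ltSeries_of_hasGoingUp l Q
    rw [← hL]
    exact le_iSup (fun L : LTSeries (PrimeSpectrum S) => ((L.length : ℕ∞) : WithBot ℕ∞)) L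
  -- Incomparability: strict inclusions of primes stay strict after contraction.
  · refine Order.krullDim_le_of_strictMono (PrimeSpectrum.comap (algebraMap R S)) ?_
    intro p q hpq
    exact Ideal.IsIntegral.comap_lt_comap (I := p.asIdeal) (J := q.asIdeal) hpq

theorem ringKrullDim_eq_of_ringHom_isIntegral {R S : Type*} [CommRing R] [CommRing S] {f : R →+* S}
    (hf : f.IsIntegral) (hinj : Function.Injective f) : ringKrullDim R = ringKrullDim S := by
  let := f.toAlgebra
  have : Algebra.IsIntegral R S := ⟨hf⟩
  exact ringKrullDim_eq_of_isIntegral hinj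

theorem _root_.RingHom.Finite.exists_fin {R S : Type*} [CommRing R] [CommRing S] {f : R →+* S}
    (hf : f.Finite) : ∃ (L : ℕ) (b : Fin L → S), ∀ x, ∃ c : Fin L → R, ∑ l, b l * f (c l) = x := by
  let := f.toAlgebra
  have : Module.Finite R S := hf
  obtain ⟨L, b, hb⟩ := Module.Finite.exists_fin (R := R) (M := S)
  refine ⟨L, b, fun x => ?_⟩
  obtain ⟨c, hc⟩ := (Submodule.mem_span_range_iff_exists_fun R).1
    (hb ▸ Submodule.mem_top : x ∈ Submodule.span R (Set.range b))
  refine ⟨c, hc ▸ Finset.sum_congr rfl fun l _ => ?_⟩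
  rw [Algebra.smul_def, mul_comm]
  rfl

/-- If `f` kills `1 ⊗ x`, freeness of `B` lets one read off that every coordinate of `f` kills `x`.
-/
theorem annihilator_baseChange_le {A B M ι : Type*} [CommRing A] [CommRing B] [Algebra A B]
    [AddCommGroup M] [Module A M] (b : Module.Basis ι A B) :
    Module.annihilator B (B ⊗[A] M) ≤ (Module.annihilator A M).map (algebraMap A B) := by
  intro f hf
  rw [Module.mem_annihilator] at hf
  have hc : ∀ i, b.repr f i ∈ Module.annihilator A M := by
    intro i
    rw [Module.mem_annihilator]
    intro x
    have h := congrArg (TensorProduct.lid A M ∘ (b.coord i).rTensor M) (hf (1 ⊗ₜ x))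
    simpa [TensorProduct.smul_tmul'] using h
  rw [← b.linearCombination_repr f, Finsupp.linearCombination_apply]
  refine Ideal.sum_mem _ fun i _ => ?_
  beta_reduce
  rw [Algebra.smul_def]
  exact Ideal.mul_mem_right _ _ (Ideal.mem_map_of_mem _ (hc i))

/-! ### Growth of affine algebras -/

section Growth

open MvPolynomial

variable {k : Type*} [Field k]

/-- Bounding the degree in each variable separately gives an exact power, which avoids binomial
coefficients in the growth estimates. -/
lemma finrank_restrictDegree (s d : ℕ) :
    Module.finrank k (restrictDegree (Fin s) k d) = (d + 1) ^ s := by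
  have b := basisRestrictSupport k {f : Fin s →₀ ℕ | ∀ i, f i ≤ d}
  have e : {f : Fin s →₀ ℕ | ∀ i, f i ≤ d} ≃ (Fin s → Fin (d + 1)) :=
    { toFun := fun f i => ⟨f.1 i, Nat.lt_succ_of_le (f.2 i)⟩
      invFun := fun f => ⟨Finsupp.equivFunOnFinite.symm fun i => (f i : ℕ),
        fun i => Nat.le_of_lt_succ (f i).2⟩
      left_inv := fun f => by ext; simp
      right_inv := fun f => by ext; simp }
  rw [restrictDegree, Module.finrank_eq_nat_card_basis b, Nat.card_congr e]
  simp

lemma finrank_restrictTotalDegree_le (s d : ℕ) :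
    Module.finrank k (restrictTotalDegree (Fin s) k d) ≤ (d + 1) ^ s := by
  rw [← finrank_restrictDegree (k := k)]
  exact Submodule.finrank_mono (restrictTotalDegree_le_restrictDegree _ _ _)

/-- The image of the polynomials of degree at most `d` in a quotient algebra. -/
def quotientFiltration {n : ℕ} (I : Ideal (MvPolynomial (Fin n) k)) (d : ℕ) :
    Submodule k (MvPolynomial (Fin n) k ⧸ I) :=
  (restrictTotalDegree (Fin n) k d).map (Ideal.Quotient.mkₐ k I).toLinearMap

instance {n : ℕ} (I : Ideal (MvPolynomial (Fin n) k)) (d : ℕ) :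
    Module.Finite k (quotientFiltration I d) := by
  unfold quotientFiltration; infer_instance

lemma totalDegree_aeval_le {n s c d : ℕ} {q : Fin s → MvPolynomial (Fin n) k}
    (hq : ∀ i, (q i).totalDegree ≤ c) {f : MvPolynomial (Fin s) k}
    (hf : f ∈ restrictDegree (Fin s) k d) : (aeval q f).totalDegree ≤ s * c * d := by
  rw [aeval_def, eval₂_eq]
  refine totalDegree_finsetSum_le fun t ht => ?_
  refine (totalDegree_mul _ _).trans ?_
  rw [algebraMap_eq, totalDegree_C, zero_add]
  refine (totalDegree_finsetProd _ _).trans ?_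
  calc ∑ i ∈ t.support, (q i ^ t i).totalDegree
      ≤ ∑ i, (q i ^ t i).totalDegree :=
        Finset.sum_le_sum_of_subset (Finset.subset_univ _)
    _ ≤ ∑ _i : Fin s, c * d := by
        refine Finset.sum_le_sum fun i _ => (totalDegree_pow _ _).trans ?_
        rw [mul_comm c d]
        exact Nat.mul_le_mul ((mem_restrictDegree _ _ _).1 hf t ht i) (hq i)
    _ = s * c * d := by simp [mul_assoc]

lemma finrank_le_of_injective_of_mapsTo {V W : Type*} [AddCommGroup V] [Module k V]
    [AddCommGroup W] [Module k W] {f : V →ₗ[k] W} (hf : Function.Injective f) {p : Submodule k V}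
    {q : Submodule k W} [Module.Finite k q] (h : ∀ x ∈ p, f x ∈ q) :
    Module.finrank k p ≤ Module.finrank k q :=
  LinearMap.finrank_le_finrank_of_injective (f := f.restrict h)
    fun _ _ hxy => Subtype.ext (hf (congrArg Subtype.val hxy))

/-- Lift the images of the variables to polynomials of degree at most `c`. Polynomials of degree at
most `d` in each of the `s` variables then map into degree at most `s c d`, injectively. -/
lemma exists_le_finrank_quotientFiltration {n s : ℕ} (I : Ideal (MvPolynomial (Fin n) k))
    (g : MvPolynomial (Fin s) k →ₐ[k] MvPolynomial (Fin n) k ⧸ I) (hg : Function.Injective g) :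
    ∃ C, ∀ d, (d + 1) ^ s ≤ Module.finrank k (quotientFiltration I (C * d)) := by
  choose q hq using fun i => Ideal.Quotient.mk_surjective (g (X i))
  have hgq : ∀ f, g f = Ideal.Quotient.mkₐ k I (aeval q f) := by
    intro f
    have : g = (Ideal.Quotient.mkₐ k I).comp (aeval q) := by
      ext i
      simp [hq]
    rw [this]; rfl
  refine ⟨s * Finset.univ.sup fun i => (q i).totalDegree, fun d => ?_⟩
  rw [← finrank_restrictDegree (k := k)]
  refine finrank_le_of_injective_of_mapsTo hg (f := g.toLinearMap) fun f hf => ?_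
  rw [AlgHom.toLinearMap_apply, hgq]
  refine Submodule.mem_map_of_mem ((mem_restrictTotalDegree _ _ _).2 ?_)
  exact totalDegree_aeval_le (fun i => Finset.le_sup (f := fun i => (q i).totalDegree)
    (Finset.mem_univ i)) hf

/-- The combinations of `b₁, …, b_L` with coefficients of degree at most `d`. -/
def combinationFiltration {s L : ℕ} {B : Type*} [CommRing B] [Algebra k B]
    (g : MvPolynomial (Fin s) k →ₐ[k] B) (b : Fin L → B) (d : ℕ) : Submodule k B :=
  (Submodule.pi Set.univ fun _ => restrictTotalDegree (Fin s) k d).map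
    (∑ l, (LinearMap.mulLeft k (b l)) ∘ₗ g.toLinearMap ∘ₗ LinearMap.proj l :
      (Fin L → MvPolynomial (Fin s) k) →ₗ[k] B)

lemma mem_combinationFiltration {s L : ℕ} {B : Type*} [CommRing B] [Algebra k B]
    {g : MvPolynomial (Fin s) k →ₐ[k] B} {b : Fin L → B} {d : ℕ} {x : B} :
    x ∈ combinationFiltration g b d ↔ ∃ f : Fin L → MvPolynomial (Fin s) k,
      (∀ l, (f l).totalDegree ≤ d) ∧ ∑ l, b l * g (f l) = x := by
  simp [combinationFiltration, Submodule.mem_pi, mem_restrictTotalDegree, LinearMap.sum_apply]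

/-- A power of a submodule as a space of functions. -/
def submodulePiEquiv (ι : Type*) {V : Type*} [AddCommGroup V] [Module k V] (W : Submodule k V) :
    (Submodule.pi Set.univ fun _ : ι => W) ≃ₗ[k] (ι → W) where
  toFun f i := ⟨f.1 i, f.2 i trivial⟩
  invFun f := ⟨fun i => f i, fun i _ => (f i).2⟩
  map_add' _ _ := rfl
  map_smul' _ _ := rfl
  left_inv _ := rfl
  right_inv _ := rfl

instance {ι V : Type*} [Finite ι] [AddCommGroup V] [Module k V] (W : Submodule k V)
    [Module.Finite k W] : Module.Finite k (Submodule.pi Set.univ fun _ : ι => W) :=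
  Module.Finite.equiv (submodulePiEquiv ι W).symm

lemma finrank_pi_fin (m : ℕ) {V : Type*} [AddCommGroup V] [Module k V] (W : Submodule k V)
    [Module.Finite k W] : Module.finrank k (Submodule.pi Set.univ fun _ : Fin m => W) =
      m * Module.finrank k W := by
  rw [(submodulePiEquiv (Fin m) W).finrank_eq, Module.finrank_pi_fintype]
  simp

/-- With module generators `b_j`, multiplication by any `X_i` raises the degree of the coefficients
by a bounded amount, so coefficient degrees grow linearly with the degree of a monomial. -/
lemma exists_finrank_quotientFiltration_le {n s : ℕ} (I : Ideal (MvPolynomial (Fin n) k))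
    (g : MvPolynomial (Fin s) k →ₐ[k] MvPolynomial (Fin n) k ⧸ I) (hg : g.Finite) :
    ∃ C, ∀ d, Module.finrank k (quotientFiltration I d) ≤ C * (d + 1) ^ s := by
  obtain ⟨L, b, hb⟩ : ∃ (L : ℕ) (b : Fin L → MvPolynomial (Fin n) k ⧸ I),
      ∀ x, ∃ f : Fin L → MvPolynomial (Fin s) k, ∑ l, b l * g (f l) = x :=
    RingHom.Finite.exists_fin hg
  choose f₁ hf₁ using hb
  -- `c` bounds the coefficients of `1` and of all products `X_i b_j`.
  set c := (Finset.univ.sup fun l => (f₁ 1 l).totalDegree) + Finset.univ.sup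
    fun p : Fin n × Fin L × Fin L =>
      (f₁ (Ideal.Quotient.mk I (X p.1) * b p.2.1) p.2.2).totalDegree with hc
  have h1 : ∀ l, (f₁ 1 l).totalDegree ≤ c := fun l =>
    (Finset.le_sup (f := fun l => (f₁ 1 l).totalDegree) (Finset.mem_univ l)).trans
      (Nat.le_add_right _ _)
  have h2 : ∀ i j l, (f₁ (Ideal.Quotient.mk I (X i) * b j) l).totalDegree ≤ c := fun i j l =>
    (Finset.le_sup (f := fun p : Fin n × Fin L × Fin L =>
      (f₁ (Ideal.Quotient.mk I (X p.1) * b p.2.1) p.2.2).totalDegree)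
      (Finset.mem_univ (i, j, l))).trans (Nat.le_add_left _ _)
  have hX : ∀ i d x, x ∈ combinationFiltration g b d →
      Ideal.Quotient.mk I (X i) * x ∈ combinationFiltration g b (d + c) := by
    intro i d x hx
    obtain ⟨f, hf, rfl⟩ := mem_combinationFiltration.1 hx
    refine mem_combinationFiltration.2
      ⟨fun l => ∑ j, f j * f₁ (Ideal.Quotient.mk I (X i) * b j) l, fun l => ?_, ?_⟩
    · refine totalDegree_finsetSum_le fun j _ => (totalDegree_mul _ _).trans ?_
      exact add_le_add (hf j) (h2 i j l)
    · simp only [map_sum, map_mul, Finset.mul_sum]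
      rw [Finset.sum_comm]
      refine Finset.sum_congr rfl fun j _ => ?_
      rw [← mul_assoc, ← hf₁ (Ideal.Quotient.mk I (X i) * b j), Finset.sum_mul]
      simp only [hf₁]
      exact Finset.sum_congr rfl fun l _ => by ring
  have hmono : ∀ {d d'}, d ≤ d' → combinationFiltration g b d ≤ combinationFiltration g b d' := by
    intro d d' h x hx
    obtain ⟨f, hf, rfl⟩ := mem_combinationFiltration.1 hx
    exact mem_combinationFiltration.2 ⟨f, fun l => (hf l).trans h, rfl⟩
  -- One `c` is spent on expressing `1` and one on each of the `d` factors.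
  have hmon : ∀ d (t : Fin n →₀ ℕ), t.degree = d →
      Ideal.Quotient.mk I (monomial t 1) ∈ combinationFiltration g b (c * (d + 1)) := by
    intro d
    induction d with
    | zero =>
      intro t ht
      rw [Finsupp.degree_eq_zero_iff] at ht
      rw [ht]
      refine mem_combinationFiltration.2 ⟨f₁ 1, by simpa using h1, ?_⟩
      rw [hf₁]
      rfl
    | succ d ih =>
      intro t ht
      obtain ⟨i, hi⟩ : ∃ i, t i ≠ 0 := by
        by_contra! h0
        rw [show t = 0 from Finsupp.ext h0] at ht
        simp at ht
      obtain ⟨u, rfl⟩ : ∃ u, t = Finsupp.single i 1 + u :=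
        ⟨t - Finsupp.single i 1, (add_tsub_cancel_of_le
          (by simpa using Nat.one_le_iff_ne_zero.2 hi)).symm⟩
      have hu : u.degree = d := by
        rw [map_add, Finsupp.degree_single] at ht
        omega
      have := hX i _ _ (ih u hu)
      rwa [← map_mul, X, monomial_mul, one_mul, show c * (d + 1) + c = c * (d + 1 + 1) by ring]
        at this
  have hle : ∀ d, quotientFiltration I d ≤ combinationFiltration g b (c * (d + 1)) := by
    rintro d _ ⟨f, hf, rfl⟩
    rw [SetLike.mem_coe, mem_restrictTotalDegree] at hf
    rw [← f.support_sum_monomial_coeff, map_sum]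
    refine Submodule.sum_mem _ fun t ht => ?_
    have : monomial t (coeff t f) = coeff t f • monomial t (1 : k) := by
      simp [smul_monomial]
    rw [this, map_smul]
    refine Submodule.smul_mem _ _ (hmono ?_ (hmon _ t rfl))
    gcongr
    exact (le_totalDegree ht).trans hf
  refine ⟨L * (c + 1) ^ s, fun d => ?_⟩
  have : Module.Finite k (combinationFiltration g b (c * (d + 1))) := by
    unfold combinationFiltration; infer_instance
  calc Module.finrank k (quotientFiltration I d)
      ≤ Module.finrank k (combinationFiltration g b (c * (d + 1))) := Submodule.finrank_mono (hle d)
    _ ≤ _ := Submodule.finrank_map_le _ _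
    _ = L * Module.finrank k (restrictTotalDegree (Fin s) k (c * (d + 1))) := by
      rw [finrank_pi_fin]
    _ ≤ L * (c * (d + 1) + 1) ^ s := by gcongr; exact finrank_restrictTotalDegree_le _ _
    _ ≤ L * ((c + 1) * (d + 1)) ^ s := by gcongr; nlinarith
    _ = L * (c + 1) ^ s * (d + 1) ^ s := by rw [mul_pow]; ring

/-- Noether normalization supplies `s`: injectivity gives the lower bound, finiteness the upper
bound, integrality the Krull dimension. By monotonicity a single `C` serves both bounds. -/
theorem exists_finrank_quotientFiltration_bounds {n : ℕ} (I : Ideal (MvPolynomial (Fin n) k))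
    (hI : I ≠ ⊤) : ∃ s C : ℕ, ringKrullDim (MvPolynomial (Fin n) k ⧸ I) = s ∧
      (∀ d, (d + 1) ^ s ≤ Module.finrank k (quotientFiltration I (C * d))) ∧
      ∀ d, Module.finrank k (quotientFiltration I d) ≤ C * (d + 1) ^ s := by
  have : Nontrivial (MvPolynomial (Fin n) k ⧸ I) := Ideal.Quotient.nontrivial_iff.2 hI
  obtain ⟨s, g, hg, hfin⟩ := exists_finite_inj_algHom_of_fg k (MvPolynomial (Fin n) k ⧸ I)
  obtain ⟨C₁, h₁⟩ := exists_le_finrank_quotientFiltration I g hg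
  obtain ⟨C₂, h₂⟩ := exists_finrank_quotientFiltration_le I g hfin
  refine ⟨s, C₁ + C₂, ?_, fun d => (h₁ d).trans (Submodule.finrank_mono ?_), fun d =>
    (h₂ d).trans (by gcongr; omega)⟩
  · rw [← ringKrullDim_eq_of_ringHom_isIntegral (f := g.toRingHom) hfin.to_isIntegral hg]
    simp
  · exact Submodule.map_mono (restrictSupport_mono k fun t ht => le_trans ht
      (Nat.mul_le_mul_right d (Nat.le_add_right _ _)))

end Growth

/-! ### Growth of a finite module against growth of the algebra modulo its annihilator. -/

section ModuleGrowth

open MvPolynomial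

variable {k : Type*} [Field k] {n m : ℕ}
  (Q : Submodule (MvPolynomial (Fin n) k) (Fin m → MvPolynomial (Fin n) k))

/-- The image of the tuples of polynomials of degree at most `d` in a quotient of a free module. -/
def moduleFiltration (d : ℕ) : Submodule k ((Fin m → MvPolynomial (Fin n) k) ⧸ Q) :=
  (Submodule.pi Set.univ fun _ => restrictTotalDegree (Fin n) k d).map (Q.mkQ.restrictScalars k)

instance (d : ℕ) : Module.Finite k (moduleFiltration Q d) := by
  unfold moduleFiltration; infer_instance

/-- The action of `A / ann (Aᵐ / Q)` on the `a`-th generator of `Aᵐ / Q`. -/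
def actionOnGenerator (a : Fin m) :
    (MvPolynomial (Fin n) k ⧸ Module.annihilator (MvPolynomial (Fin n) k)
      ((Fin m → MvPolynomial (Fin n) k) ⧸ Q)) →ₗ[MvPolynomial (Fin n) k]
      ((Fin m → MvPolynomial (Fin n) k) ⧸ Q) :=
  Submodule.liftQ _ (LinearMap.toSpanSingleton _ _ (Q.mkQ (Pi.single a 1))) fun _ hf =>
    Module.mem_annihilator.1 hf _

lemma actionOnGenerator_mk (a : Fin m) (f : MvPolynomial (Fin n) k) :
    actionOnGenerator Q a (Ideal.Quotient.mk _ f) = Q.mkQ (Pi.single a f) := by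
  change f • Q.mkQ (Pi.single a 1) = _
  rw [← map_smul, ← Pi.single_smul, smul_eq_mul, mul_one]

lemma mem_annihilator_quotient_iff (f : MvPolynomial (Fin n) k) :
    f ∈ Module.annihilator (MvPolynomial (Fin n) k) ((Fin m → MvPolynomial (Fin n) k) ⧸ Q) ↔
      ∀ a, Pi.single a f ∈ Q := by
  rw [Module.mem_annihilator]
  constructor
  · intro h a
    have := h (Q.mkQ (Pi.single a 1))
    rwa [← map_smul, ← Pi.single_smul, smul_eq_mul, mul_one, Submodule.mkQ_apply,
      Submodule.Quotient.mk_eq_zero] at this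
  · intro h x
    obtain ⟨φ, rfl⟩ := Q.mkQ_surjective x
    rw [← map_smul, Submodule.mkQ_apply, Submodule.Quotient.mk_eq_zero,
      ← Finset.univ_sum_single (f • φ)]
    refine Submodule.sum_mem _ fun a _ => ?_
    have : Pi.single a ((f • φ) a) = φ a • (Pi.single a f : Fin m → MvPolynomial (Fin n) k) := by
      rw [← Pi.single_smul, Pi.smul_apply, smul_eq_mul, smul_eq_mul, mul_comm]
    rw [this]
    exact Q.smul_mem _ (h a)

/-- The `m` generators present the module as a quotient of the `m`-th power of `A / ann`, compatibly
with degrees. -/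
lemma finrank_moduleFiltration_le (d : ℕ) :
    Module.finrank k (moduleFiltration Q d) ≤
      m * Module.finrank k (quotientFiltration (Module.annihilator (MvPolynomial (Fin n) k)
        ((Fin m → MvPolynomial (Fin n) k) ⧸ Q)) d) := by
  rw [← finrank_pi_fin]
  refine (Submodule.finrank_mono ?_).trans (Submodule.finrank_map_le
    (∑ a, (actionOnGenerator Q a).restrictScalars k ∘ₗ LinearMap.proj a) _)
  rintro _ ⟨φ, hφ, rfl⟩
  refine ⟨fun a => Ideal.Quotient.mk _ (φ a), fun a _ => ⟨φ a, hφ a trivial, rfl⟩, ?_⟩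
  simp only [LinearMap.sum_apply, LinearMap.comp_apply, LinearMap.proj_apply,
    LinearMap.restrictScalars_apply, actionOnGenerator_mk]
  rw [← map_sum, Finset.univ_sum_single]

/-- Acting on the `m` generators embeds `A / ann` into the `m`-th power of the module. -/
lemma finrank_quotientFiltration_le (d : ℕ) :
    Module.finrank k (quotientFiltration (Module.annihilator (MvPolynomial (Fin n) k)
        ((Fin m → MvPolynomial (Fin n) k) ⧸ Q)) d) ≤
      m * Module.finrank k (moduleFiltration Q d) := by
  rw [← finrank_pi_fin]
  refine finrank_le_of_injective_of_mapsTo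
    (f := LinearMap.pi fun a => (actionOnGenerator Q a).restrictScalars k) ?_ ?_
  · rw [injective_iff_map_eq_zero]
    intro x hx
    obtain ⟨f, rfl⟩ := Ideal.Quotient.mk_surjective x
    rw [Ideal.Quotient.eq_zero_iff_mem, mem_annihilator_quotient_iff]
    intro a
    have := congrFun hx a
    rwa [LinearMap.pi_apply, LinearMap.restrictScalars_apply, actionOnGenerator_mk,
      Submodule.mkQ_apply, Pi.zero_apply, Submodule.Quotient.mk_eq_zero] at this
  · rintro _ ⟨f, hf, rfl⟩ a -
    refine ⟨Pi.single a f, fun b _ => ?_, (actionOnGenerator_mk Q a f).symm⟩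
    obtain rfl | hb := eq_or_ne b a
    · simpa using hf
    · simp [hb]

theorem exists_finrank_moduleFiltration_bounds
    (hQ : Module.annihilator (MvPolynomial (Fin n) k)
      ((Fin m → MvPolynomial (Fin n) k) ⧸ Q) ≠ ⊤) : ∃ s C : ℕ,
      ringKrullDim (MvPolynomial (Fin n) k ⧸ Module.annihilator (MvPolynomial (Fin n) k)
        ((Fin m → MvPolynomial (Fin n) k) ⧸ Q)) = s ∧
      (∀ d, (d + 1) ^ s ≤ m * Module.finrank k (moduleFiltration Q (C * d))) ∧
      ∀ d, Module.finrank k (moduleFiltration Q d) ≤ m * (C * (d + 1) ^ s) := by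
  obtain ⟨s, C, hs, h₁, h₂⟩ := exists_finrank_quotientFiltration_bounds _ hQ
  exact ⟨s, C, hs, fun d => (h₁ d).trans (finrank_quotientFiltration_le Q _), fun d =>
    (finrank_moduleFiltration_le Q d).trans (Nat.mul_le_mul_left _ (h₂ d))⟩

end ModuleGrowth

/-! ### The pairing and the filtration of the symbolic module -/

section Pairing

open MvPolynomial

variable {n m : ℕ}

lemma pairing_apply (f q : MvPolynomial (Fin n) ℝ) :
    pairing n f q = ∑ s ∈ f.support, f.coeff s * ((∏ i, ((s i).factorial : ℝ)) * q.coeff s) := by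
  conv_lhs => rw [← f.support_sum_monomial_coeff]
  rw [map_sum, LinearMap.sum_apply]
  refine Finset.sum_congr rfl fun s _ => ?_
  rw [show monomial s (coeff s f) = coeff s f • monomial s (1 : ℝ) by simp [smul_monomial],
    map_smul, LinearMap.smul_apply, pairing_monomial, smul_eq_mul]

lemma pairing_self_nonneg (f : MvPolynomial (Fin n) ℝ) : 0 ≤ pairing n f f := by
  rw [pairing_apply]
  refine Finset.sum_nonneg fun s _ => ?_
  rw [mul_left_comm]
  exact mul_nonneg (Finset.prod_nonneg fun _ _ => Nat.cast_nonneg _) (mul_self_nonneg _)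

lemma pairing_self_eq_zero {f : MvPolynomial (Fin n) ℝ} (h : pairing n f f = 0) : f = 0 := by
  rw [pairing_apply, Finset.sum_eq_zero_iff_of_nonneg] at h
  · ext s
    by_contra hs
    have := h s (mem_support_iff.2 hs)
    have hp : (∏ i, ((s i).factorial : ℝ)) ≠ 0 :=
      Finset.prod_ne_zero_iff.2 fun i _ => Nat.cast_ne_zero.2 (Nat.factorial_ne_zero _)
    rw [coeff_zero] at hs
    simp [hp, hs] at this
  · intro s _
    rw [mul_left_comm]
    exact mul_nonneg (Finset.prod_nonneg fun _ _ => Nat.cast_nonneg _) (mul_self_nonneg _)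

lemma pairing_eq_zero_of_totalDegree_lt {f q : MvPolynomial (Fin n) ℝ} {i : ℕ}
    (hf : f.totalDegree < i) (hq : q.IsHomogeneous i) : pairing n f q = 0 := by
  rw [pairing_apply]
  refine Finset.sum_eq_zero fun s hs => ?_
  rw [hq.coeff_eq_zero (d := s) ((le_totalDegree hs).trans_lt hf).ne, mul_zero, mul_zero]

/-- The pairing of `ST ⊗ N*` with `ST* ⊗ N`. -/
def vectorPairing (n m : ℕ) : VPoly n m →ₗ[ℝ] Module.Dual ℝ (VPoly n m) :=
  ∑ a, (LinearMap.proj a).dualMap ∘ₗ pairing n ∘ₗ LinearMap.proj a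

lemma vectorPairing_apply (φ p : VPoly n m) :
    vectorPairing n m φ p = ∑ a, pairing n (φ a) (p a) := by
  simp [vectorPairing, LinearMap.sum_apply]

/-- Monomials are orthogonal with positive squares `s!`, so over `ℝ` the pairing is an inner product
and remains nondegenerate on every subspace. -/
lemma vectorPairing_self_eq_zero {p : VPoly n m} (h : vectorPairing n m p p = 0) : p = 0 := by
  rw [vectorPairing_apply, Finset.sum_eq_zero_iff_of_nonneg fun _ _ => pairing_self_nonneg _] at h
  exact funext fun a => pairing_self_eq_zero (h a (Finset.mem_univ a))

lemma homog_le_pi_restrictTotalDegree {i d : ℕ} (h : i ≤ d) :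
    homog n m i ≤ Submodule.pi Set.univ fun _ => restrictTotalDegree (Fin n) ℝ d :=
  fun _ hp a _ => (mem_restrictTotalDegree _ _ _).2 ((mem_homog.1 hp a).totalDegree_le.trans h)

end Pairing

namespace SymbolicSystem

open MvPolynomial

variable {n m : ℕ} (g : SymbolicSystem n m)

instance (i : ℕ) : Module.Finite ℝ (g.g i) :=
  Submodule.finiteDimensional_of_le
    ((g.le_homog i).trans (homog_le_pi_restrictTotalDegree le_rfl))

lemma mem_perp_iff {φ : VPoly n m} :
    φ ∈ g.perp ↔ ∀ i, ∀ p ∈ g.g i, vectorPairing n m φ p = 0 := by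
  simp only [vectorPairing_apply]
  rfl

/-- The sum map `g₀ × ⋯ × g_d → ST* ⊗ N`. -/
def sumMap (d : ℕ) : ((i : Fin (d + 1)) → g.g i) →ₗ[ℝ] VPoly n m :=
  ∑ i : Fin (d + 1), (g.g i).subtype ∘ₗ LinearMap.proj i

lemma sumMap_apply (d : ℕ) (x : (i : Fin (d + 1)) → g.g i) :
    g.sumMap d x = ∑ i, (x i : VPoly n m) := by
  simp [sumMap, LinearMap.sum_apply]

lemma sumMap_injective (d : ℕ) : Function.Injective (g.sumMap d) := by
  rw [injective_iff_map_eq_zero]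
  intro x hx
  funext i
  ext a : 2
  have := congrArg (homogeneousComponent (i : ℕ)) (congrFun hx a)
  rw [sumMap_apply, Finset.sum_apply, map_sum, Finset.sum_eq_single i] at this
  · rw [homogeneousComponent_of_mem (mem_homog.1 (g.le_homog _ (x i).2) a), if_pos rfl] at this
    simpa using this
  · intro j _ hj
    rw [homogeneousComponent_of_mem (mem_homog.1 (g.le_homog _ (x j).2) a), if_neg]
    exact fun h => hj (Fin.ext h.symm)
  · simp

lemma mem_range_sumMap {d i : ℕ} (hi : i ≤ d) {p : VPoly n m} (hp : p ∈ g.g i) :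
    p ∈ LinearMap.range (g.sumMap d) := by
  refine ⟨Pi.single (⟨i, Nat.lt_succ_of_le hi⟩ : Fin (d + 1)) ⟨p, hp⟩, ?_⟩
  rw [sumMap_apply, Finset.sum_eq_single (⟨i, Nat.lt_succ_of_le hi⟩ : Fin (d + 1))]
  · simp
  · intro j _ hj
    simp [hj]
  · simp

lemma vectorPairing_eq_zero_of_mem_perp {φ : VPoly n m} (hφ : φ ∈ g.perp) {d : ℕ} {p : VPoly n m}
    (hp : p ∈ LinearMap.range (g.sumMap d)) : vectorPairing n m φ p = 0 := by
  obtain ⟨x, rfl⟩ := hp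
  rw [sumMap_apply, map_sum]
  exact Finset.sum_eq_zero fun i _ => g.mem_perp_iff.1 hφ _ _ (x i).2

/-- The sum `G` of `g_0, …, g_d`, read inside `ST ⊗ N*`, is a system of representatives for the
classes of degree at most `d`: it meets `g^⊥` only in `0` by positivity, and it represents every
class by duality on `G`. -/
lemma finrank_moduleFiltration (d : ℕ) :
    Module.finrank ℝ (moduleFiltration g.perp d) =
      ∑ i ∈ Finset.range (d + 1), Module.finrank ℝ (g.g i) := by
  set G := LinearMap.range (g.sumMap d) with hG
  have hGle : G ≤ Submodule.pi Set.univ fun _ => restrictTotalDegree (Fin n) ℝ d := by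
    rintro _ ⟨x, rfl⟩
    rw [sumMap_apply]
    exact Submodule.sum_mem _ fun i _ =>
      homog_le_pi_restrictTotalDegree (Nat.le_of_lt_succ i.2) (g.le_homog _ (x i).2)
  have hmap : moduleFiltration g.perp d = G.map (g.perp.mkQ.restrictScalars ℝ) := by
    refine le_antisymm ?_ (Submodule.map_mono hGle)
    rintro _ ⟨φ, hφ, rfl⟩
    let B : G →ₗ[ℝ] Module.Dual ℝ G := (vectorPairing n m).domRestrict₁₂ G G
    have hB : Function.Injective B := by
      rw [injective_iff_map_eq_zero]
      intro x hx
      exact Subtype.ext (vectorPairing_self_eq_zero (LinearMap.congr_fun hx x))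
    have hBs : Function.Surjective B :=
      (LinearMap.injective_iff_surjective_of_finrank_eq_finrank Subspace.dual_finrank_eq.symm).1 hB
    -- `p` is the orthogonal projection of `φ` to `G`. Then `p - φ` annihilates `g_i` for `i ≤ d` by
    -- construction and for `i > d` by degree.
    obtain ⟨p, hp⟩ := hBs ((vectorPairing n m φ).domRestrict G)
    refine ⟨p, p.2, ?_⟩
    rw [← sub_eq_zero, ← map_sub]
    refine (Submodule.Quotient.mk_eq_zero _).2 (g.mem_perp_iff.2 fun i q hq => ?_)
    obtain hi | hi := le_or_gt i d
    · have := LinearMap.congr_fun hp ⟨q, g.mem_range_sumMap hi hq⟩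
      rw [map_sub, LinearMap.sub_apply, sub_eq_zero]
      exact this
    · rw [vectorPairing_apply]
      refine Finset.sum_eq_zero fun a _ => pairing_eq_zero_of_totalDegree_lt (lt_of_le_of_lt ?_ hi)
        (mem_homog.1 (g.le_homog i hq) a)
      exact (mem_restrictTotalDegree _ _ _).1 (Submodule.sub_mem _ (hGle p.2) hφ a trivial)
  have hinj : Function.Injective (g.perp.mkQ.restrictScalars ℝ ∘ₗ g.sumMap d) := by
    rw [injective_iff_map_eq_zero]
    intro x hx
    refine (injective_iff_map_eq_zero _).1 (g.sumMap_injective d) x ?_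
    exact vectorPairing_self_eq_zero (g.vectorPairing_eq_zero_of_mem_perp
      ((Submodule.Quotient.mk_eq_zero _).1 hx) ⟨x, rfl⟩)
  rw [hmap, hG, ← LinearMap.range_comp, LinearMap.finrank_range_of_inj hinj,
    Module.finrank_pi_fintype,
    Fin.sum_univ_eq_sum_range (fun i => Module.finrank ℝ (g.g i))]

end SymbolicSystem

/-! ### Euler characteristics of the Spencer complexes -/

section SpencerComplex

variable {n m : ℕ}

lemma pderiv_pderiv_comm (i j : Fin n) (f : MvPolynomial (Fin n) ℝ) :
    MvPolynomial.pderiv i (MvPolynomial.pderiv j f) =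
      MvPolynomial.pderiv j (MvPolynomial.pderiv i f) := by
  have h : ⁅MvPolynomial.pderiv (R := ℝ) (σ := Fin n) i,
      MvPolynomial.pderiv (R := ℝ) (σ := Fin n) j⁆ = 0 := by
    refine MvPolynomial.derivation_ext fun l => ?_
    classical
    simp [Derivation.commutator_apply, MvPolynomial.pderiv_X, Pi.single_apply, apply_ite]
  rw [← sub_eq_zero, ← Derivation.commutator_apply, h, Derivation.zero_apply]

lemma dirD_dirD_comm (v w : Fin n → ℝ) (p : VPoly n m) :
    dirD n m v (dirD n m w p) = dirD n m w (dirD n m v p) := by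
  funext a
  simp only [dirD_apply, map_sum, Finset.smul_sum, Derivation.map_smul]
  rw [Finset.sum_comm]
  refine Finset.sum_congr rfl fun i _ => Finset.sum_congr rfl fun j _ => ?_
  rw [smul_comm, pderiv_pderiv_comm]

lemma spencerD_apply {j : ℕ} (ω : Form n m j) (v : Fin (j + 1) → Fin n → ℝ) :
    spencerD n m j ω v =
      ∑ s : Fin (j + 1), (-1 : ℤ) ^ (s : ℕ) • dirD n m (v s) (ω (s.removeNth v)) :=
  AlternatingMap.alternatizeUncurryFin_apply _ _

/-- Directional derivatives commute, and a double alternatization of something symmetric in two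
arguments vanishes. -/
lemma spencerD_spencerD {j : ℕ} (ω : Form n m j) :
    spencerD n m (j + 1) (spencerD n m j ω) = 0 := by
  let f : (Fin n → ℝ) →ₗ[ℝ] (Fin n → ℝ) →ₗ[ℝ] Form n m j := LinearMap.mk₂ ℝ
    (fun v w => (dirD n m v ∘ₗ dirD n m w).compAlternatingMap ω)
    (fun _ _ _ => by ext1; simp) (fun _ _ _ => by ext1; simp)
    (fun _ _ _ => by ext1; simp) (fun _ _ _ => by ext1; simp)
  have hf : ∀ v w, f v w = f w v := fun v w => by
    ext1 u
    exact dirD_dirD_comm v w (ω u)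
  rw [← AlternatingMap.alternatizeUncurryFin_alternatizeUncurryFinLM_comp_of_symmetric hf]
  ext1 v
  rw [spencerD_apply, AlternatingMap.alternatizeUncurryFin_apply]
  refine Finset.sum_congr rfl fun s _ => ?_
  congr 1
  rw [spencerD_apply, map_sum]
  simp only [map_zsmul, LinearMap.comp_apply, AlternatingMap.alternatizeUncurryFinLM_apply,
    AlternatingMap.alternatizeUncurryFin_apply]
  exact Finset.sum_congr rfl fun t _ => rfl

lemma finrank_eq_finrank_subquotient_add {K V : Type} [Field K] [AddCommGroup V] [Module K V]
    {Z B : Submodule K V} [Module.Finite K Z] (h : B ≤ Z) :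
    Module.finrank K Z = Module.finrank K (Subquotient Z B) + Module.finrank K B := by
  rw [← (Submodule.submoduleOfEquivOfLe h).finrank_eq]
  exact (Submodule.finrank_quotient_add_finrank _).symm

end SpencerComplex

namespace SymbolicSystem

variable {n m : ℕ} (g : SymbolicSystem n m)

/-- `g_i ⊗ Λ^j T*` as a space of linear maps. -/
def cochainsEquiv (i j : ℕ) :
    g.cochains i j ≃ₗ[ℝ] (⋀[ℝ]^j (Fin n → ℝ)) →ₗ[ℝ] g.g i :=
  LinearEquiv.trans
    { toFun := fun ω => ω.1.codRestrict (g.g i) ω.2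
      invFun := fun ω => ⟨(g.g i).subtype.compAlternatingMap ω, fun v => (ω v).2⟩
      map_add' := fun _ _ => rfl
      map_smul' := fun _ _ => rfl
      left_inv := fun _ => rfl
      right_inv := fun _ => rfl }
    exteriorPower.alternatingMapLinearEquiv

instance (i j : ℕ) : Module.Finite ℝ (g.cochains i j) :=
  have : Module.Finite ℝ ((⋀[ℝ]^j (Fin n → ℝ)) →ₗ[ℝ] g.g i) := Module.Finite.linearMap ..
  Module.Finite.equiv (g.cochainsEquiv i j).symm

lemma finrank_cochains (i j : ℕ) :
    Module.finrank ℝ (g.cochains i j) = Module.finrank ℝ (g.g i) * n.choose j := by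
  rw [(g.cochainsEquiv i j).finrank_eq, Module.finrank_linearMap, exteriorPower.finrank_eq,
    Module.finrank_fin_fun, mul_comm]

lemma spencerD_mem_cochains {i j : ℕ} {ω : Form n m j} (hω : ω ∈ g.cochains (i + 1) j) :
    spencerD n m j ω ∈ g.cochains i (j + 1) := by
  intro v
  rw [spencerD_apply]
  exact Submodule.sum_mem _ fun s _ =>
    Submodule.smul_of_tower_mem _ _ (g.dirD_mem _ _ (hω _) _)

lemma coboundaries_le_cocycles (i j : ℕ) : g.coboundaries i j ≤ g.cocycles i j := by
  cases j with
  | zero => exact bot_le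
  | succ j =>
    rintro _ ⟨ω, hω, rfl⟩
    exact ⟨g.spencerD_mem_cochains hω, spencerD_spencerD ω⟩

/-- Elements of `g_0` are constants. Thus at the end of each complex the cocycles are all cochains,
and `h^{0,j}` is the dimension of a cokernel. -/
lemma cocycles_zero (j : ℕ) : g.cocycles 0 j = g.cochains 0 j := by
  refine inf_eq_left.2 fun ω hω => ?_
  rw [LinearMap.mem_ker]
  ext1 v
  rw [spencerD_apply]
  refine Finset.sum_eq_zero fun s _ => ?_
  rw [show dirD n m (v s) (ω (s.removeNth v)) = 0 from ?_, smul_zero]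
  funext a
  rw [dirD_apply]
  refine Finset.sum_eq_zero fun i _ => ?_
  have h0 := mem_homog.1 (g.le_homog 0 (hω (s.removeNth v))) a
  rw [MvPolynomial.totalDegree_eq_zero_iff_eq_C.1 (Nat.le_zero.1 h0.totalDegree_le),
    MvPolynomial.pderiv_C, smul_zero]

lemma finrank_cochains_succ (i j : ℕ) :
    Module.finrank ℝ (g.cochains (i + 1) j) =
      Module.finrank ℝ (g.cocycles (i + 1) j) + Module.finrank ℝ (g.coboundaries i (j + 1)) := by
  have h := LinearMap.finrank_range_add_finrank_ker (K := ℝ)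
    (V := g.cochains (i + 1) j) (V₂ := Form n m (j + 1))
    ((spencerD n m j).domRestrict (g.cochains (i + 1) j))
  rw [LinearMap.range_domRestrict, LinearMap.ker_domRestrict,
    ← Submodule.finrank_map_subtype_eq, Submodule.map_comap_subtype] at h
  rw [← h, add_comm]
  rfl

lemma finrank_cocycles (i j : ℕ) :
    Module.finrank ℝ (g.cocycles i j) = g.h i j + Module.finrank ℝ (g.coboundaries i j) := by
  have : Module.Finite ℝ (g.cocycles i j) :=
    Submodule.finiteDimensional_of_le (inf_le_left : g.cocycles i j ≤ g.cochains i j)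
  exact finrank_eq_finrank_subquotient_add (g.coboundaries_le_cocycles i j)

lemma alternating_sum_finrank_cochains (hg : ∀ i j, g.h (i + 1) j = 0) (k : ℕ) :
    ∑ j ∈ Finset.range (k + 1), (-1 : ℚ) ^ j * Module.finrank ℝ (g.cochains (k - j) j) =
      (-1) ^ k * g.h 0 k := by
  -- Telescoping: all terms have polynomial degree at least `i + 1 ≥ 1`, where the cohomology
  -- vanishes, so only the rank of the last differential survives.
  have hpartial : ∀ J i, ∑ j ∈ Finset.range (J + 1),
      (-1 : ℚ) ^ j * Module.finrank ℝ (g.cochains (i + 1 + J - j) j) =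
        (-1) ^ J * Module.finrank ℝ (g.coboundaries i (J + 1)) := by
    intro J
    induction J with
    | zero =>
      intro i
      have : Module.finrank ℝ (g.coboundaries (i + 1) 0) = 0 := finrank_bot ℝ _
      simp [finrank_cochains_succ, finrank_cocycles, hg, this]
    | succ J ih =>
      intro i
      have := ih (i + 1)
      rw [Finset.sum_range_succ]
      rw [show i + 1 + 1 + J = i + 1 + (J + 1) by ring] at this
      rw [this, Nat.add_sub_cancel, finrank_cochains_succ, finrank_cocycles, hg]
      push_cast
      ring
  cases k with
  | zero =>
    have : Module.finrank ℝ (g.coboundaries 0 0) = 0 := finrank_bot ℝ _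
    rw [zero_add, Finset.sum_range_one, Nat.sub_zero, ← cocycles_zero, finrank_cocycles, this,
      add_zero]
  | succ J =>
    have := hpartial J 0
    rw [Finset.sum_range_succ]
    rw [show 0 + 1 + J = J + 1 by ring] at this
    rw [this, Nat.sub_self, ← cocycles_zero, finrank_cocycles]
    push_cast
    ring

lemma h_zero_eq_zero_of_lt {k : ℕ} (hk : n < k) : g.h 0 k = 0 := by
  have h := g.finrank_cocycles 0 k
  rw [cocycles_zero, finrank_cochains, Nat.choose_eq_zero_of_lt hk, mul_zero] at h
  omega

/-- The polynomial `∑ᵢ (-1)^i h^{0,i} t^i`. -/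
def eulerPolynomial : Polynomial ℚ :=
  ∑ i ∈ Finset.range (n + 1), Polynomial.monomial i ((-1) ^ i * (g.h 0 i : ℚ))

lemma coeff_eulerPolynomial (k : ℕ) : g.eulerPolynomial.coeff k = (-1) ^ k * g.h 0 k := by
  simp only [eulerPolynomial, Polynomial.finsetSum_coeff, Polynomial.coeff_monomial]
  rw [Finset.sum_ite_eq']
  split_ifs with h
  · rfl
  · rw [g.h_zero_eq_zero_of_lt (by simpa using h)]
    simp

lemma coeff_one_sub_X_pow (n j : ℕ) :
    PowerSeries.coeff j ((1 - PowerSeries.X : PowerSeries ℚ) ^ n) = (-1) ^ j * n.choose j := by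
  have : (1 - PowerSeries.X : PowerSeries ℚ) ^ n =
      PowerSeries.rescale (-1) (((1 + Polynomial.X : Polynomial ℚ) ^ n : Polynomial ℚ)) := by
    simp [sub_eq_add_neg]
  rw [this, PowerSeries.coeff_rescale, Polynomial.coeff_coe, Polynomial.coeff_one_add_X_pow]

/-- Since `dim Λ^j T* = binom(n, j)`, the coefficient of `t^k` on the left is the Euler
characteristic of the `k`-th Spencer complex. -/
lemma mk_finrank_mul_one_sub_X_pow (hg : ∀ i j, g.h (i + 1) j = 0) :
    PowerSeries.mk (fun i => (Module.finrank ℝ (g.g i) : ℚ)) * (1 - PowerSeries.X : PowerSeries ℚ) ^ n =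
      g.eulerPolynomial := by
  ext k
  rw [mul_comm, PowerSeries.coeff_mul, Polynomial.coeff_coe, coeff_eulerPolynomial,
    ← g.alternating_sum_finrank_cochains hg, Finset.Nat.sum_antidiagonal_eq_sum_range_succ_mk]
  refine Finset.sum_congr rfl fun j _ => ?_
  rw [coeff_one_sub_X_pow, PowerSeries.coeff_mk, finrank_cochains]
  push_cast
  ring

/-- The exponent is `n + 1` and not `n` because passing to partial sums divides the series by one
more factor `1 - t`. -/
theorem isHilbertPolynomial_hilbertPoly (hg : ∀ i j, g.h (i + 1) j = 0) :
    g.IsHilbertPolynomial (g.eulerPolynomial.hilbertPoly (n + 1)) := by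
  filter_upwards [eventually_gt_atTop g.eulerPolynomial.natDegree] with k hk
  rw [← Polynomial.coeff_mul_invOneSubPow_eq_hilbertPoly_eval (n + 1) hk,
    ← g.mk_finrank_mul_one_sub_X_pow hg, mul_assoc, add_comm n 1,
    PowerSeries.one_sub_pow_mul_invOneSubPow_val_add_eq_invOneSubPow_val,
    PowerSeries.invOneSubPow_val_one_eq_invUnitSub_one, PowerSeries.coeff_mul,
    Finset.Nat.sum_antidiagonal_eq_sum_range_succ_mk]
  refine Finset.sum_congr rfl fun i _ => ?_
  simp [Subspace.dual_finrank_eq]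

lemma IsHilbertPolynomial.unique {g : SymbolicSystem n m} {P R : Polynomial ℚ}
    (hP : g.IsHilbertPolynomial P) (hR : g.IsHilbertPolynomial R) : P = R := by
  obtain ⟨N, hN⟩ := eventually_atTop.1 (hP.and hR)
  refine Polynomial.eq_of_infinite_eval_eq P R (Set.Infinite.mono ?_
    ((Set.Ici_infinite N).image Nat.cast_injective.injOn))
  rintro _ ⟨k, hk, rfl⟩
  exact (hN k hk).1.trans (hN k hk).2.symm

lemma IsHilbertPolynomial.hilbertPolynomial_eq {g : SymbolicSystem n m} {P : Polynomial ℚ}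
    (hP : g.IsHilbertPolynomial P) : g.hilbertPolynomial = P := by
  have h : ∃ P, g.IsHilbertPolynomial P := ⟨P, hP⟩
  rw [hilbertPolynomial, dif_pos h]
  exact h.choose_spec.unique hP

end SymbolicSystem

/-! ### Degrees and highest coefficients of Hilbert polynomials -/

section PolynomialLemmas

open Polynomial

/-- Otherwise `R / P` would tend to `0`, although it is eventually at least `1`. -/
lemma degree_le_of_eventually_eval_le {P R : ℚ[X]}
    (h : ∀ᶠ d : ℕ in atTop, 0 < P.eval (d : ℚ) ∧ P.eval (d : ℚ) ≤ R.eval (d : ℚ)) :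
    P.degree ≤ R.degree := by
  by_contra! hlt
  have ht := (div_tendsto_atTop_zero_of_degree_lt R P hlt).comp
    (tendsto_natCast_atTop_atTop (R := ℚ))
  obtain ⟨d, hd, hd'⟩ := (h.and (ht.eventually_lt_const one_pos)).exists
  rw [Function.comp_apply, div_lt_one hd.1] at hd'
  exact absurd hd.2 (not_le.2 hd')

lemma natDegree_eq_of_polynomial_growth {P : ℚ[X]} {H : ℕ → ℕ} {s m C : ℕ}
    (hP : ∀ᶠ d : ℕ in atTop, P.eval (d : ℚ) = H d)
    (h₁ : ∀ d, (d + 1) ^ s ≤ m * H (C * d)) (h₂ : ∀ d, H d ≤ m * (C * (d + 1) ^ s)) :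
    P.natDegree = s := by
  have hpos : ∀ d, 0 < m * H (C * d) := fun d => lt_of_lt_of_le (by positivity) (h₁ d)
  -- `C = 0` would force `H 0 = 0`, against the lower bound at `d = 0`.
  have hC : 0 < C := by
    rw [Nat.pos_iff_ne_zero]
    rintro rfl
    have := h₂ (0 * 0)
    simp only [zero_mul, mul_zero, Nat.le_zero] at this
    simpa [this] using hpos 0
  have hC' : (C : ℚ) ≠ 0 := by exact_mod_cast hC.ne'
  -- The lower bound is only known along multiples of `C`; rescaling the variable by `C ≠ 0` keeps
  -- the degree.
  set U := P.comp (Polynomial.C (C : ℚ) * X) with hU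
  have hUdeg : U.natDegree = P.natDegree := by
    rw [hU, natDegree_comp, natDegree_C_mul_X _ hC', mul_one]
  have hUe : ∀ᶠ d : ℕ in atTop, U.eval (d : ℚ) = H (C * d) := by
    filter_upwards [(tendsto_id.const_mul_atTop' hC).eventually hP] with d hd
    simpa [hU] using hd
  rw [← hUdeg]
  apply le_antisymm
  · have hle : U.degree ≤ (Polynomial.C ((m : ℚ) * C) *
        (Polynomial.C (C : ℚ) * X + Polynomial.C 1) ^ s).degree := by
      refine degree_le_of_eventually_eval_le ?_
      filter_upwards [hUe] with d hd
      rw [hd]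
      refine ⟨by exact_mod_cast Nat.pos_of_mul_pos_left (hpos d), ?_⟩
      have := h₂ (C * d)
      simp only [eval_mul, eval_C, eval_pow, eval_add, eval_X, mul_assoc]
      exact_mod_cast this
    refine (natDegree_le_natDegree hle).trans ((natDegree_C_mul_le _ _).trans ?_)
    refine natDegree_pow_le.trans ?_
    rw [natDegree_linear hC', mul_one]
  · have hle : ((X + Polynomial.C 1 : ℚ[X]) ^ s).degree ≤ (Polynomial.C (m : ℚ) * U).degree := by
      refine degree_le_of_eventually_eval_le ?_
      filter_upwards [hUe] with d hd
      have := h₁ d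
      simp only [eval_mul, eval_C, eval_pow, eval_add, eval_X, hd]
      exact ⟨by positivity, by exact_mod_cast this⟩
    have := natDegree_le_natDegree hle
    rw [natDegree_pow, natDegree_X_add_C, mul_one] at this
    exact this.trans (natDegree_C_mul_le _ _)

/-- `binom(z - i + n, n)` is the translate by `-i` of `binom(z + n, n)`, so Taylor expansion makes
its coefficients polynomials in `-i`. -/
lemma coeff_preHilbertPoly (n i c : ℕ) (hc : c ≤ n) :
    (preHilbertPoly ℚ n i).coeff (n - c) =
      ∑ l ∈ Finset.range (c + 1), ((l + (n - c)).choose (n - c) : ℚ) *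
        (preHilbertPoly ℚ n 0).coeff (l + (n - c)) * (-(i : ℚ)) ^ l := by
  have h : preHilbertPoly ℚ n i = taylor (-(i : ℚ)) (preHilbertPoly ℚ n 0) := by
    simp only [preHilbertPoly, taylor_apply, smul_comp, comp_assoc]
    congr 2
    simp [sub_eq_add_neg]
  rw [h, taylor_coeff, eval_eq_sum_range' (n := c + 1)]
  · simp only [hasseDeriv_coeff]
  · refine Nat.lt_succ_of_le ((natDegree_hasseDeriv_le _ _).trans ?_)
    rw [natDegree_preHilbertPoly]
    omega

lemma coeff_hilbertPoly (Q : ℚ[X]) (n c : ℕ) (hc : c ≤ n) :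
    (hilbertPoly Q (n + 1)).coeff (n - c) =
      ∑ l ∈ Finset.range (c + 1), ((l + (n - c)).choose (n - c) : ℚ) *
        (preHilbertPoly ℚ n 0).coeff (l + (n - c)) *
          ∑ i ∈ Q.support, Q.coeff i * (-(i : ℚ)) ^ l := by
  simp only [hilbertPoly_succ, finsetSum_coeff, coeff_smul, smul_eq_mul,
    coeff_preHilbertPoly _ _ _ hc, Finset.mul_sum]
  rw [Finset.sum_comm]
  exact Finset.sum_congr rfl fun l _ => Finset.sum_congr rfl fun i _ => by ring

/-- The leading coefficient of a Hilbert polynomial of degree `p` in terms of the numerator of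
the Hilbert series. -/
theorem eval_iterate_derivative_hilbertPoly (Q : ℚ[X]) {n p : ℕ} (hp : p ≤ n)
    (hdeg : (hilbertPoly Q (n + 1)).natDegree = p) :
    (derivative^[p] (hilbertPoly Q (n + 1))).eval 0 =
      ∑ i ∈ Q.support, Q.coeff i * ((-(i : ℚ)) ^ (n - p) / ((n - p).factorial : ℚ)) := by
  have hn : (n.factorial : ℚ) ≠ 0 := Nat.cast_ne_zero.2 n.factorial_ne_zero
  have htop : ∀ c ≤ n, (∀ l < c, ∑ i ∈ Q.support, Q.coeff i * (-(i : ℚ)) ^ l = 0) →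
      (hilbertPoly Q (n + 1)).coeff (n - c) = (n.choose (n - c) : ℚ) * (n.factorial : ℚ)⁻¹ *
        ∑ i ∈ Q.support, Q.coeff i * (-(i : ℚ)) ^ c := by
    intro c hc h0
    rw [coeff_hilbertPoly Q n c hc, Finset.sum_range_succ, Finset.sum_eq_zero, zero_add,
      Nat.add_sub_cancel' hc, coeff_preHilbertPoly_self]
    intro l hl
    rw [h0 l (Finset.mem_range.1 hl), mul_zero]
  -- The system relating coefficients to moments is triangular with nonzero diagonal `binom(n, c) /
  -- n!`. The coefficients above degree `p` vanish, hence so do these moments, one after another.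
  have hvanish : ∀ c < n - p, ∑ i ∈ Q.support, Q.coeff i * (-(i : ℚ)) ^ c = 0 := by
    intro c
    induction c using Nat.strong_induction_on with
    | _ c ih =>
      intro hc
      have h := htop c (by omega) fun l hl => ih l hl (by omega)
      rw [coeff_eq_zero_of_natDegree_lt (by omega)] at h
      have hch : (n.choose (n - c) : ℚ) ≠ 0 :=
        Nat.cast_ne_zero.2 (Nat.choose_pos (Nat.sub_le _ _)).ne'
      exact ((mul_eq_zero.1 h.symm).resolve_left (mul_ne_zero hch (inv_ne_zero hn)))
  have h := htop (n - p) (Nat.sub_le _ _) hvanish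
  rw [Nat.sub_sub_self hp] at h
  rw [← coeff_zero_eq_eval_zero, coeff_iterate_derivative, zero_add, Nat.descFactorial_self,
    nsmul_eq_mul, h]
  simp only [← mul_div_assoc]
  rw [← Finset.sum_div, ← mul_assoc, div_eq_inv_mul]
  congr 1
  -- What remains is `p! · binom(n, p) / n! = 1 / (n-p)!`.
  rw [Nat.cast_choose ℚ hp]
  have hp' : (p.factorial : ℚ) ≠ 0 := Nat.cast_ne_zero.2 p.factorial_ne_zero
  field_simp

end PolynomialLemmas

/-! ### The dimension of the characteristic variety -/

section Homogeneous

open MvPolynomial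

variable {n m : ℕ}

lemma pairing_eq_zero_of_isHomogeneous {f q : MvPolynomial (Fin n) ℝ} {d i : ℕ}
    (hf : f.IsHomogeneous d) (hq : q.IsHomogeneous i) (h : d ≠ i) : pairing n f q = 0 := by
  rw [pairing_apply]
  refine Finset.sum_eq_zero fun s hs => ?_
  rw [hq.coeff_eq_zero (d := s) (fun h' => h ?_), mul_zero, mul_zero]
  rw [← h']
  by_contra h''
  exact mem_support_iff.1 hs (hf.coeff_eq_zero fun e => h'' e.symm)

lemma pairing_homogeneousComponent (d : ℕ) (f : MvPolynomial (Fin n) ℝ)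
    {q : MvPolynomial (Fin n) ℝ} {i : ℕ} (hq : q.IsHomogeneous i) :
    pairing n (homogeneousComponent d f) q = if d = i then pairing n f q else 0 := by
  split_ifs with h
  · subst h
    conv_rhs => rw [← sum_homogeneousComponent f]
    rw [map_sum, LinearMap.sum_apply]
    by_cases hd : d ∈ Finset.range (f.totalDegree + 1)
    · rw [Finset.sum_eq_single_of_mem d hd fun j _ hj => pairing_eq_zero_of_isHomogeneous
        (homogeneousComponent_isHomogeneous j f) hq hj]
    · rw [homogeneousComponent_eq_zero _ _ (by simpa using hd), map_zero, LinearMap.zero_apply]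
      refine (Finset.sum_eq_zero fun j hj => ?_).symm
      exact pairing_eq_zero_of_isHomogeneous (homogeneousComponent_isHomogeneous j f) hq
        fun h => hd (h ▸ hj)
  · exact pairing_eq_zero_of_isHomogeneous (homogeneousComponent_isHomogeneous d f) hq h

lemma aeval_smul_of_isHomogeneous {f : MvPolynomial (Fin n) ℝ} {d : ℕ} (hf : f.IsHomogeneous d)
    (c : ℂ) (ξ : Fin n → ℂ) : aeval (c • ξ) f = c ^ d * aeval ξ f := by
  simp only [aeval_def, eval₂_eq, Finset.mul_sum]
  refine Finset.sum_congr rfl fun s hs => ?_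
  have hd : ∑ i ∈ s.support, s i = d := by
    by_contra h
    exact mem_support_iff.1 hs (hf.coeff_eq_zero h)
  simp only [Pi.smul_apply, smul_eq_mul, mul_pow, Finset.prod_mul_distrib,
    Finset.prod_pow_eq_pow_sum, hd]
  ring

lemma smul_mem_zeroLocus {I : Ideal (MvPolynomial (Fin n) ℝ)}
    (hI : ∀ f ∈ I, ∀ d, homogeneousComponent d f ∈ I) {ξ : Fin n → ℂ} (hξ : ξ ∈ zeroLocus ℂ I)
    (c : ℂ) : c • ξ ∈ zeroLocus ℂ I := by
  intro f hf
  rw [← sum_homogeneousComponent f, map_sum]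
  refine Finset.sum_eq_zero fun d _ => ?_
  rw [aeval_smul_of_isHomogeneous (homogeneousComponent_isHomogeneous d f), hξ _ (hI f hf d),
    mul_zero]

lemma zeroLocus_nonempty {I : Ideal (MvPolynomial (Fin n) ℝ)} (hI : I ≠ ⊤) :
    (zeroLocus ℂ I).Nonempty := by
  rw [Set.nonempty_iff_ne_empty]
  intro h
  have := vanishingIdeal_zeroLocus_eq_radical (K := ℂ) I
  rw [h, vanishingIdeal_empty, eq_comm, Ideal.radical_eq_top] at this
  exact hI this

/-- The support of a finite module is the zero locus of its annihilator. Complexification only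
extends the annihilator, as `ℂ[x]` is free over `ℝ[x]` on the basis coming from `1, i`. -/
lemma mem_support_baseChange_iff {M : Type*} [AddCommGroup M] [Module (MvPolynomial (Fin n) ℝ) M]
    [Module.Finite (MvPolynomial (Fin n) ℝ) M] (ξ : Fin n → ℂ) :
    (pointToPoint ξ : PrimeSpectrum (MvPolynomial (Fin n) ℂ)) ∈
        Module.support (MvPolynomial (Fin n) ℂ)
          (MvPolynomial (Fin n) ℂ ⊗[MvPolynomial (Fin n) ℝ] M) ↔
      ξ ∈ zeroLocus ℂ (Module.annihilator (MvPolynomial (Fin n) ℝ) M) := by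
  have hev : ∀ f : MvPolynomial (Fin n) ℝ,
      aeval ξ (algebraMap (MvPolynomial (Fin n) ℝ) (MvPolynomial (Fin n) ℂ) f) = aeval ξ f := by
    intro f
    rw [algebraMap_def, aeval_map_algebraMap]
  rw [Module.mem_support_iff_of_finite]
  change _ ≤ vanishingIdeal ℂ {ξ} ↔ _
  constructor
  · intro h f hf
    rw [← hev, ← mem_vanishingIdeal_singleton_iff]
    refine h (Module.mem_annihilator.2 fun x => ?_)
    rw [algebraMap_smul]
    induction x with
    | zero => rw [smul_zero]
    | tmul b y => rw [TensorProduct.smul_tmul', TensorProduct.smul_tmul,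
        Module.mem_annihilator.1 hf, TensorProduct.tmul_zero]
    | add x y hx hy => rw [smul_add, hx, hy, add_zero]
  · intro h
    have b := (((Algebra.isPushout_iff ℝ (MvPolynomial (Fin n) ℝ) ℂ (MvPolynomial (Fin n) ℂ)).1
      inferInstance).basis Complex.basisOneI)
    refine (annihilator_baseChange_le b).trans (Ideal.map_le_iff_le_comap.2 fun f hf => ?_)
    rw [Ideal.mem_comap, mem_vanishingIdeal_singleton_iff, hev]
    exact h f hf

/-- The real vanishing ideal is the contraction of the complex one, so the two quotients form an
injective integral extension. -/
lemma ringKrullDim_quotient_vanishingIdeal (S : Set (Fin n → ℂ)) :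
    ringKrullDim (MvPolynomial (Fin n) ℂ ⧸ vanishingIdeal ℂ S) =
      ringKrullDim (MvPolynomial (Fin n) ℝ ⧸ vanishingIdeal ℝ S) := by
  have h : vanishingIdeal ℝ S = (vanishingIdeal ℂ S).comap
      (algebraMap (MvPolynomial (Fin n) ℝ) (MvPolynomial (Fin n) ℂ)) := by
    ext f
    simp only [Ideal.mem_comap, mem_vanishingIdeal_iff, algebraMap_def, aeval_map_algebraMap]
  rw [h]
  exact (ringKrullDim_eq_of_ringHom_isIntegral
    (RingHom.IsIntegral.quotient _ Algebra.IsIntegral.isIntegral)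
    Ideal.quotientMap_injective).symm

lemma ringKrullDim_quotient_radical {R : Type*} [CommRing R] (I : Ideal R) :
    ringKrullDim (R ⧸ I.radical) = ringKrullDim (R ⧸ I) := by
  rw [ringKrullDim_quotient, ringKrullDim_quotient, PrimeSpectrum.zeroLocus_radical]

lemma HasCodim.ringKrullDim_eq {p : ℕ} (hp : p ≤ n) {X : Set (ℙ ℂ (Fin n → ℂ))}
    (h : HasCodim X (n - p)) :
    ringKrullDim (MvPolynomial (Fin n) ℂ ⧸ vanishingIdeal ℂ (affineCone X)) = p := by
  obtain ⟨c, hc⟩ : ∃ c, n - p = c := ⟨_, rfl⟩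
  rw [hc, HasCodim] at h
  generalize ringKrullDim (MvPolynomial (Fin n) ℂ ⧸
    vanishingIdeal ℂ (affineCone X)) = D at h ⊢
  induction D with
  | bot => simp at h
  | coe D =>
    induction D with
    | top =>
      have h' : (⊤ : ℕ∞) + c = n := by exact_mod_cast h
      simp at h'
    | coe D =>
      have h' : D + c = n := by exact_mod_cast h
      have : D = p := by omega
      rw [this]
      rfl

end Homogeneous

namespace SymbolicSystem

open MvPolynomial

variable {n m : ℕ} (g : SymbolicSystem n m)

/-- The annihilator of the symbolic module. -/
abbrev charIdeal : Ideal (MvPolynomial (Fin n) ℝ) :=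
  Module.annihilator (MvPolynomial (Fin n) ℝ) g.symbolicModule

/-- The `g_i` consist of homogeneous polynomials, so the conditions defining `g^⊥` can be tested
degree by degree. -/
lemma homogeneousComponent_mem_charIdeal {f : MvPolynomial (Fin n) ℝ} (hf : f ∈ g.charIdeal)
    (d : ℕ) : homogeneousComponent d f ∈ g.charIdeal := by
  rw [mem_annihilator_quotient_iff] at hf ⊢
  intro a i p hp
  have h := hf a i p hp
  have hsum : ∀ f : MvPolynomial (Fin n) ℝ,
      ∑ b, pairing n ((Pi.single a f : VPoly n m) b) (p b) = pairing n f (p a) := by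
    intro f
    rw [Finset.sum_eq_single a]
    · simp
    · intro b _ hb
      simp [hb]
    · simp
  rw [hsum] at h ⊢
  rw [pairing_homogeneousComponent d f (mem_homog.1 (g.le_homog i hp) a), h, ite_self]

/-- The affine cone contains the origin by definition. That the zero locus does too needs a proper
ideal: it has a zero by the Nullstellensatz, and homogeneity allows scaling it to `0`. -/
lemma affineCone_charVariety (hI : g.charIdeal ≠ ⊤) :
    affineCone g.charVariety = zeroLocus ℂ g.charIdeal := by
  have hsmul : ∀ {ξ : Fin n → ℂ}, ξ ∈ zeroLocus ℂ g.charIdeal → ∀ c : ℂ,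
      c • ξ ∈ zeroLocus ℂ g.charIdeal := fun hξ c =>
    smul_mem_zeroLocus (fun _ hf d => g.homogeneousComponent_mem_charIdeal hf d) hξ c
  ext ξ
  constructor
  · rintro (rfl | ⟨hξ, ξ', hξ', he, hs⟩)
    · obtain ⟨η, hη⟩ := zeroLocus_nonempty hI
      rw [← zero_smul ℂ η]
      exact hsmul hη 0
    · obtain ⟨c, hc⟩ := (Projectivization.mk_eq_mk_iff' ℂ _ _ hξ hξ').1 he.symm
      rw [← hc]
      exact hsmul ((mem_support_baseChange_iff ξ').1 hs) c
  · intro hξ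
    by_cases h0 : ξ = 0
    · exact Or.inl h0
    · exact Or.inr ⟨h0, ξ, h0, rfl, (mem_support_baseChange_iff ξ).2 hξ⟩

lemma affineCone_charVariety_of_charIdeal_eq_top (hI : g.charIdeal = ⊤) :
    affineCone g.charVariety = {0} := by
  ext ξ
  constructor
  · rintro (rfl | ⟨hξ, ξ', hξ', he, hs⟩)
    · rfl
    · have := (mem_support_baseChange_iff ξ').1 hs
      rw [show Module.annihilator (MvPolynomial (Fin n) ℝ) g.symbolicModule = ⊤ from hI,
        zeroLocus_top] at this
      exact this.elim
  · rintro rfl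
    exact Or.inl rfl

theorem ringKrullDim_affineCone_charVariety (hI : g.charIdeal ≠ ⊤) :
    ringKrullDim (MvPolynomial (Fin n) ℂ ⧸ vanishingIdeal ℂ (affineCone g.charVariety)) =
      ringKrullDim (MvPolynomial (Fin n) ℝ ⧸ g.charIdeal) := by
  rw [g.affineCone_charVariety hI, ringKrullDim_quotient_vanishingIdeal,
    vanishingIdeal_zeroLocus_eq_radical, ringKrullDim_quotient_radical]

theorem ringKrullDim_affineCone_charVariety_of_charIdeal_eq_top (hI : g.charIdeal = ⊤) :
    ringKrullDim (MvPolynomial (Fin n) ℂ ⧸ vanishingIdeal ℂ (affineCone g.charVariety)) = 0 := by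
  rw [g.affineCone_charVariety_of_charIdeal_eq_top hI]
  have : (vanishingIdeal ℂ {(0 : Fin n → ℂ)} : Ideal (MvPolynomial (Fin n) ℂ)).IsMaximal :=
    isMaximal_iff_eq_vanishingIdeal_singleton.2 ⟨0, rfl⟩
  let := Ideal.Quotient.field
    (vanishingIdeal ℂ {(0 : Fin n → ℂ)} : Ideal (MvPolynomial (Fin n) ℂ))
  exact ringKrullDim_eq_zero_of_field _

/-- The degree of the Hilbert polynomial is the affine dimension of the characteristic variety. -/
theorem IsHilbertPolynomial.natDegree_eq {g : SymbolicSystem n m} {P : Polynomial ℚ}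
    (hP : g.IsHilbertPolynomial P) {p : ℕ} (hp : p ≤ n) (h : HasCodim g.charVariety (n - p)) :
    P.natDegree = p := by
  have hdim := HasCodim.ringKrullDim_eq hp h
  have hP' : ∀ᶠ k : ℕ in atTop,
      P.eval (k : ℚ) = Module.finrank ℝ (moduleFiltration g.perp k) := by
    filter_upwards [hP] with k hk
    rw [hk, g.finrank_moduleFiltration]
    simp [Subspace.dual_finrank_eq]
  -- When `g* = 0` the cone is `{0}`, of dimension `0`, and `P = 0` has `natDegree` equal to `0`, so
  -- `p = 0` agrees with the convention for the empty variety.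
  by_cases hI : g.charIdeal = ⊤
  · rw [g.ringKrullDim_affineCone_charVariety_of_charIdeal_eq_top hI] at hdim
    have hp0 : p = 0 := by exact_mod_cast hdim.symm
    have : Subsingleton g.symbolicModule := Module.annihilator_eq_top_iff.1 hI
    have hz : g.IsHilbertPolynomial 0 := by
      refine Eventually.of_forall fun k => ?_
      have h0 := g.finrank_moduleFiltration k
      rw [show Module.finrank ℝ (moduleFiltration g.perp k) = 0 from
        Module.finrank_zero_of_subsingleton] at h0
      simp only [Subspace.dual_finrank_eq]
      rw [← Nat.cast_sum, ← h0]
      simp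
    rw [hP.unique hz, hp0, Polynomial.natDegree_zero]
  · obtain ⟨s, C, hs, h₁, h₂⟩ := exists_finrank_moduleFiltration_bounds g.perp hI
    rw [natDegree_eq_of_polynomial_growth hP' h₁ h₂]
    rw [g.ringKrullDim_affineCone_charVariety hI, hs] at hdim
    exact_mod_cast hdim

/-- The functional dimension and rank of an acyclic symbolic system. -/
theorem functionalDimension_and_functionalRank (hg : ∀ i j, g.h (i + 1) j = 0) {p : ℕ}
    (hp : p ≤ n) (hcodim : HasCodim g.charVariety (n - p)) :
    g.IsHilbertPolynomial g.hilbertPolynomial ∧ g.functionalDimension = p ∧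
      g.functionalRank = ∑ i ∈ Finset.range (n + 1),
        (-1 : ℚ) ^ i * (g.h 0 i : ℚ) * ((-(i : ℚ)) ^ (n - p) / ((n - p).factorial : ℚ)) := by
  have hP := g.isHilbertPolynomial_hilbertPoly hg
  have hdeg := hP.natDegree_eq hp hcodim
  rw [functionalRank, functionalDimension, hP.hilbertPolynomial_eq, hdeg,
    eval_iterate_derivative_hilbertPoly _ hp hdeg]
  refine ⟨hP, rfl, ?_⟩
  rw [Finset.sum_subset (s₂ := Finset.range (n + 1))]
  · simp only [coeff_eulerPolynomial]
  · intro i hi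
    rw [Polynomial.mem_support_iff, coeff_eulerPolynomial] at hi
    rw [Finset.mem_range]
    by_contra h
    exact hi (by rw [g.h_zero_eq_zero_of_lt (by omega)]; simp)
  · intro i _ hi
    rw [Polynomial.notMem_support_iff.1 hi, zero_mul]

end SymbolicSystem

/-! ### Acyclicity of the symbol of an involutive first-order system. -/

namespace FirstOrderSystem

variable {n m r : ℕ} (E : FirstOrderSystem n m r)

/-- This turns the order-one case of involutivity, a statement on the system generated by `g_1`,
into one on the symbol itself. -/
lemma trunc_one_symbol (θ : Jet1 n m) : (E.symbol θ).trunc 1 le_rfl = E.symbol θ := by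
  have h : (E.symbol θ).g 1 = E.firstSymbol θ := by
    simp [symbol, generated, prolongation]
  unfold SymbolicSystem.trunc symbol
  congr 1

lemma h_succ_eq_zero_of_involutive {θ : Jet1 n m} (h : (E.symbol θ).Involutive) (i j : ℕ) :
    (E.symbol θ).h (i + 1) j = 0 := by
  have := h 1 le_rfl (i + 1) j (by omega)
  rw [trunc_one_symbol] at this
  exact Module.finrank_zero_of_subsingleton

end FirstOrderSystem

end SpencerPDE

end

theorem mainTheorem1 (n m r : ℕ) (E : SpencerPDE.FirstOrderSystem n m r)
    (hE : E.FormallyIntegrable) (θ : SpencerPDE.Jet1 n m) (hθ : θ ∈ E.equation)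
    (hinv : (E.symbol θ).Involutive)
    (p : ℕ) (hp : p ≤ n) (hcodim : SpencerPDE.HasCodim (E.symbol θ).charVariety (n - p)) :
    (E.symbol θ).IsHilbertPolynomial (E.symbol θ).hilbertPolynomial ∧
    (E.symbol θ).functionalDimension = p ∧
    (E.symbol θ).functionalRank =
      ∑ i ∈ Finset.range (n + 1),
        (-1 : ℚ) ^ i * ((E.symbol θ).h 0 i : ℚ) * ((-(i : ℚ)) ^ (n - p) / ((n - p).factorial : ℚ)) :=
  (E.symbol θ).functionalDimension_and_functionalRank (E.h_succ_eq_zero_of_involutive hinv) hp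
    hcodim
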